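/- **Setting.** Let $H$ be a complex Hilbert space, $\Delta$ a strictly positive (i.e. self-adjoint with $\Delta\ge\varepsilon$ for some $\varepsilon>0$) possibly unbounded operator on $H$, and $r\ge 2$ an integer. Put $H^\infty=\bigcap_n \mathrm{dom}(\Delta^n)$; the complex powers $\Delta^z$ act on $H^\infty$. For $t\in\mathbb R$, $\mathrm{Op}^t$ is the set of linear operators $T$ on $H^\infty$ such that for every $s\in\mathbb R$ there is $C$ with $\|\Delta^{(s-t)/r}Tv\|\le C\|\Delta^{s/r}v\|$ for all $v\in H^\infty$, and $\mathrm{Op}=\bigcup_t\mathrm{Op}^t$. Algebras are complex, associative, and need not be unital; filtrations are increasing, exhaustive and multiplicative. A filtration-preserving automorphism maps each filtration step onto itself. * A *twisted algebra of DOs* is an $\mathbb N$-filtered algebra $\mathcal D=\bigcup_m\mathcal D^m$ of operators on $H^\infty$ with a filtration-preserving linear automorphism $\theta$ such that $\Delta X-\theta^r(X)\Delta\in\mathcal D^{m+r-1}$ for $X\in\mathcal D^m$, and for each $X\in\mathcal D^m$ there is $C>0$ with $\|Xv\|\le C\|\Delta^{m/r}v\|$ for all $v\in H^\infty$. * A *twisted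 algebra of $\Psi$DOs* is an $\mathbb R$-filtered algebra $\Psi=\bigcup_t\Psi^t\subseteq\mathrm{Op}$ with a family $(\Theta^z)_{z\in\mathbb C}$ of filtration-preserving algebra automorphisms such that, for all $z\in\mathbb C$, $t\in\mathbb R$: $\Delta^{z/r}\Psi^t\subseteq\Psi^{\mathrm{Re}z+t}$ and $\Psi^t\Delta^{z/r}\subseteq\Psi^{\mathrm{Re}z+t}$; $\Delta^{z/r}P-\Theta^z(P)\Delta^{z/r}\in\Psi^{\mathrm{Re}z+t-1}$ for $P\in\Psi^t$; and $\Psi^0\subseteq\mathrm{Op}^0$. * A *twisted algebra of $\Psi$DO$_0$s* is an algebra $\mathcal B$ of operators on $H^\infty$, bounded for the norm of $H$, with a linear automorphism $\theta$ such that $\Delta^{1/r}b-\theta(b)\Delta^{1/r}\in\mathcal B$ for all $b\in\mathcal B$. Let $\mathcal A$ be an algebra of linear operators on $H^\infty$ with an algebra automorphism $\theta$. *Compatible with $\mathcal A$* means: for $\mathcal D$, that $\mathcal A\subseteq\mathcal D^0$ and the twisting of $\mathcal D$ extends $\theta$; for $\mathcal B$, that $\mathcal A\subseteq\mathcal B$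 and the twisting of $\mathcal B$ extends $\theta$; for $\Psi$, that $\mathcal A\subseteq\Psi^0$ and $\Theta^1(a)-\theta(a)\in\Psi^{-1}$ for all $a\in\mathcal A$. **Theorem.** 1. If $\mathcal A$ admits a compatible twisted algebra of $\Psi$DOs, then it admits a compatible twisted algebra of $\Psi$DO$_0$s. 2. If $\mathcal A$ admits a compatible twisted algebra of $\Psi$DO$_0$s, then it admits a compatible twisted algebra of DOs. 3. Let $\mathcal D$ be a twisted algebra of DOs compatible with $\mathcal A$ whose twisting is diagonalizable ($\mathcal D$ is the algebraic direct sum of its eigenspaces) with positive spectrum. Then $\mathcal A$ admits a compatible twisted algebra of $\Psi$DOs $\Psi$. It can be chosen so that $\Theta^z(P)=\Delta^{z/r}P\Delta^{-z/r}$ for all $z\in\mathbb C$, $P\in\Psi$, and so that $\Psi^t$ consists exactly of the operators $P$ on $H^\infty$ such that for every $l\in\mathbb R$, $P$ is equal, modulo $\mathrm{Op}^{l}$, to a finite sum of operators $X\Delta^{(z-m)/r}$ with $m\in\mathbb N$, $X\in\mathcal D^m$, $z\in\mathbb C$, $\mathrm{Re}\,z\le t$. -/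

import Mathlib

open scoped InnerProductSpace

/-- An abstract Laplace operator on a complex Hilbert space `H`: a strictly positive (that is,
self-adjoint and bounded below by some `ε > 0`) partially defined operator.  Self-adjointness
includes density of the domain. -/
structure AbstractLaplacian (H : Type*) [NormedAddCommGroup H] [InnerProductSpace ℂ H]
    [CompleteSpace H] where
  op : H →ₗ.[ℂ] H
  selfAdjoint : IsSelfAdjoint op
  strictlyPositive : ∃ ε : ℝ, 0 < ε ∧ ∀ x : op.domain,
    ε * ‖(x : H)‖ ^ 2 ≤ (⟪(x : H), op x⟫_ℂ).re

namespace AbstractLaplacian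

variable {H : Type*} [NormedAddCommGroup H] [InnerProductSpace ℂ H] [CompleteSpace H]
variable (Δ : AbstractLaplacian H)

/-! ### The bounded inverse -/

theorem exists_lower_bound : ∃ ε : ℝ, 0 < ε ∧ ∀ x : Δ.op.domain, ε * ‖(x : H)‖ ≤ ‖Δ.op x‖ := by
  obtain ⟨ε, hε, h⟩ := Δ.strictlyPositive
  refine ⟨ε, hε, fun x => ?_⟩
  rcases (norm_nonneg (x : H)).eq_or_lt with h0 | h0
  · rw [← h0]; simp
  · have h1 := h x
    have h2 : (⟪(x : H), Δ.op x⟫_ℂ).re ≤ ‖(x : H)‖ * ‖Δ.op x‖ :=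
      (Complex.re_le_norm _).trans (norm_inner_le_norm _ _)
    nlinarith

theorem injective_op : Function.Injective Δ.op.toFun := by
  obtain ⟨ε, hε, h⟩ := Δ.exists_lower_bound
  rw [injective_iff_map_eq_zero]
  intro x hx
  have h1 := h x
  have h2 : Δ.op x = 0 := hx
  rw [h2, norm_zero] at h1
  have h3 : ‖(x : H)‖ = 0 := le_antisymm (by
    by_contra hc
    push Not at hc
    nlinarith) (norm_nonneg _)
  exact Subtype.ext (by simpa using h3)

theorem isClosed_range_op : IsClosed (LinearMap.range Δ.op.toFun : Set H) := by
  obtain ⟨ε, hε, h⟩ := Δ.exists_lower_bound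
  have hcl : IsClosed (Δ.op.graph : Set (H × H)) := Δ.selfAdjoint.isClosed
  rw [← isSeqClosed_iff_isClosed]
  intro y y₀ hy hlim
  choose x hx using hy
  have hcau : CauchySeq fun n => (x n : H) := by
    rw [Metric.cauchySeq_iff']
    intro δ hδ
    obtain ⟨N, hN⟩ := Metric.cauchySeq_iff'.1 hlim.cauchySeq (ε * δ) (by positivity)
    refine ⟨N, fun n hn => ?_⟩
    have h1 := hN n hn
    have h2 := h (x n - x N)
    rw [dist_eq_norm] at h1 ⊢
    have h3 : Δ.op (x n - x N) = y n - y N := by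
      rw [LinearPMap.map_sub, ← hx n, ← hx N]; rfl
    rw [h3] at h2
    have h4 : ε * ‖(x n : H) - x N‖ < ε * δ := lt_of_le_of_lt (by simpa using h2) h1
    exact lt_of_mul_lt_mul_left h4 hε.le
  obtain ⟨x₀, hx₀⟩ := cauchySeq_tendsto_of_complete hcau
  have hmem : ((x₀, y₀) : H × H) ∈ Δ.op.graph := by
    refine hcl.mem_of_tendsto (hx₀.prodMk_nhds hlim) (Filter.Eventually.of_forall fun n => ?_)
    have := Δ.op.mem_graph (x n)
    rwa [show Δ.op (x n) = y n from hx n] at this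
  obtain ⟨z, -, hz⟩ := Δ.op.mem_graph_iff.1 hmem
  exact ⟨z, hz⟩

theorem surjective_op : Function.Surjective Δ.op.toFun := by
  rw [← LinearMap.range_eq_top]
  have : CompleteSpace (LinearMap.range Δ.op.toFun) :=
    Δ.isClosed_range_op.completeSpace_coe
  rw [← Submodule.orthogonal_eq_bot_iff, Submodule.eq_bot_iff]
  intro y hy
  have h0 : ∀ x : Δ.op.domain, ⟪(0 : H), (x : H)⟫_ℂ = ⟪y, Δ.op x⟫_ℂ := by
    intro x
    rw [inner_zero_left]
    exact ((Submodule.mem_orthogonal' _ _).1 hy _ ⟨x, rfl⟩).symm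
  have hself : Δ.op.adjoint = Δ.op := Δ.selfAdjoint
  have hdom : y ∈ Δ.op.adjoint.domain := LinearPMap.mem_adjoint_domain_of_exists y ⟨0, h0⟩
  rw [hself] at hdom
  obtain ⟨ε, hε, h⟩ := Δ.strictlyPositive
  have h1 := h ⟨y, hdom⟩
  rw [← h0 ⟨y, hdom⟩, inner_zero_left] at h1
  simp only [Complex.zero_re] at h1
  have h2 : ‖y‖ ^ 2 ≤ 0 := by
    by_contra hc
    push Not at hc
    nlinarith
  have h3 : ‖y‖ = 0 := by nlinarith [norm_nonneg y]
  simpa using h3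

/-- `Δ` as a linear bijection from its domain onto `H`. -/
noncomputable def opEquiv : Δ.op.domain ≃ₗ[ℂ] H :=
  LinearEquiv.ofBijective Δ.op.toFun ⟨Δ.injective_op, Δ.surjective_op⟩

/-- The bounded inverse `Δ⁻¹ : H → H`. -/
noncomputable def inv : H →L[ℂ] H :=
  LinearMap.mkContinuousOfExistsBound (Δ.op.domain.subtype ∘ₗ Δ.opEquiv.symm.toLinearMap) (by
    obtain ⟨ε, hε, h⟩ := Δ.exists_lower_bound
    refine ⟨ε⁻¹, fun y => ?_⟩
    have h1 := h (Δ.opEquiv.symm y)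
    have h2 : Δ.op (Δ.opEquiv.symm y) = y := Δ.opEquiv.apply_symm_apply y
    rw [h2] at h1
    rw [inv_mul_eq_div, le_div_iff₀ hε, mul_comm]
    exact h1)

theorem inv_mem_domain (y : H) : Δ.inv y ∈ Δ.op.domain := (Δ.opEquiv.symm y).2

theorem op_inv (y : H) : Δ.op ⟨Δ.inv y, Δ.inv_mem_domain y⟩ = y := Δ.opEquiv.apply_symm_apply y

theorem inv_op (x : Δ.op.domain) : Δ.inv (Δ.op x) = x :=
  congrArg Subtype.val (Δ.opEquiv.symm_apply_apply x)

/-! ### Smooth vectors -/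

/-- The domain of `Δ ^ n`. -/
def powDomain : ℕ → Submodule ℂ H
  | 0 => ⊤
  | n + 1 => ((powDomain n).comap Δ.op.toFun).map Δ.op.domain.subtype

/-- The space `H^∞` of vectors in the domain of all powers of `Δ`. -/
def Hinf : Submodule ℂ H := ⨅ n, Δ.powDomain n

theorem mem_powDomain_succ {n : ℕ} {x : H} :
    x ∈ Δ.powDomain (n + 1) ↔ ∃ h : x ∈ Δ.op.domain, Δ.op ⟨x, h⟩ ∈ Δ.powDomain n := by
  constructor
  · rintro ⟨y, hy, rfl⟩
    exact ⟨y.2, hy⟩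
  · rintro ⟨h, hx⟩
    exact ⟨⟨x, h⟩, hx, rfl⟩

theorem mem_Hinf {x : H} : x ∈ Δ.Hinf ↔ ∀ n, x ∈ Δ.powDomain n := by
  simp [Hinf]

theorem Hinf_le_domain : Δ.Hinf ≤ Δ.op.domain := fun _ hx =>
  (Δ.mem_powDomain_succ.1 (Δ.mem_Hinf.1 hx 1)).1

theorem op_mem_Hinf {x : H} (hx : x ∈ Δ.Hinf) : Δ.op ⟨x, Δ.Hinf_le_domain hx⟩ ∈ Δ.Hinf :=
  Δ.mem_Hinf.2 fun n => (Δ.mem_powDomain_succ.1 (Δ.mem_Hinf.1 hx (n + 1))).2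

/-- `Δ` as a linear operator on `H^∞`. -/
def lap : Module.End ℂ Δ.Hinf where
  toFun v := ⟨Δ.op ⟨v, Δ.Hinf_le_domain v.2⟩, Δ.op_mem_Hinf v.2⟩
  map_add' v w := Subtype.ext (Δ.op.map_add ⟨v, _⟩ ⟨w, _⟩)
  map_smul' c v := Subtype.ext (Δ.op.map_smul c ⟨v, _⟩)

/-- A bounded operator commuting with `Δ⁻¹` preserves the domain of each power of `Δ`. -/
theorem map_mem_powDomain {S : H →L[ℂ] H} (hS : Commute S Δ.inv) (n : ℕ) :
    ∀ x ∈ Δ.powDomain n, S x ∈ Δ.powDomain n := by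
  induction n with
  | zero => intro x _; trivial
  | succ n ih =>
    intro x hx
    obtain ⟨h, hx⟩ := Δ.mem_powDomain_succ.1 hx
    have h1 : S x = Δ.inv (S (Δ.op ⟨x, h⟩)) := by
      have h2 := congrArg (fun T : H →L[ℂ] H => T (Δ.op ⟨x, h⟩)) hS.eq
      simp only [mul_apply_eq_comp, Δ.inv_op] at h2
      exact h2
    rw [h1]
    refine Δ.mem_powDomain_succ.2 ⟨Δ.inv_mem_domain _, ?_⟩
    rw [Δ.op_inv]
    exact ih _ hx

theorem map_mem_Hinf {S : H →L[ℂ] H} (hS : Commute S Δ.inv) {x : H} (hx : x ∈ Δ.Hinf) :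
    S x ∈ Δ.Hinf :=
  Δ.mem_Hinf.2 fun n => Δ.map_mem_powDomain hS n x (Δ.mem_Hinf.1 hx n)

/-! ### Complex powers, Sobolev norms, analytic order -/

/-- The bounded operator `(Δ⁻¹) ^ w`, by continuous functional calculus (used for `0 < Re w`, where
`x ↦ x ^ w` is continuous on the spectrum of `Δ⁻¹`). -/
noncomputable def invPow (w : ℂ) : H →L[ℂ] H := cfc (fun x : ℂ => x ^ w) Δ.inv

theorem isSelfAdjoint_inv : IsSelfAdjoint Δ.inv := by
  rw [ContinuousLinearMap.isSelfAdjoint_iff_isSymmetric]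
  intro x y
  have hfa := LinearPMap.adjoint_isFormalAdjoint Δ.selfAdjoint.dense_domain
  rw [show Δ.op.adjoint = Δ.op from Δ.selfAdjoint] at hfa
  have h := hfa ⟨Δ.inv x, Δ.inv_mem_domain x⟩ ⟨Δ.inv y, Δ.inv_mem_domain y⟩
  rw [Δ.op_inv, Δ.op_inv] at h
  exact h.symm

theorem commute_invPow (w : ℂ) : Commute (Δ.invPow w) Δ.inv :=
  Δ.isSelfAdjoint_inv.commute_cfc (Commute.refl _) _

/-- The complex power `Δ ^ z` on `H^∞`: for any natural number `n > Re z`, it is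
`(Δ⁻¹) ^ (n - z) Δ ^ n`. -/
noncomputable def cpow (z : ℂ) : Module.End ℂ Δ.Hinf :=
  ((Δ.invPow ((⌈z.re⌉₊ + 1 : ℕ) - z)).toLinearMap.restrict
    (fun _ hx => Δ.map_mem_Hinf (Δ.commute_invPow _) hx)) * Δ.lap ^ (⌈z.re⌉₊ + 1)

/-- The Sobolev norm `‖v‖_s = ‖Δ ^ (s / r) v‖` on `H^∞`. -/
noncomputable def sobolevNorm (r : ℕ) (s : ℝ) (v : Δ.Hinf) : ℝ :=
  ‖Δ.cpow ((s : ℂ) / r) v‖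

/-- `T ∈ Op^t`: for every real `s`, `T` is bounded from the `s`-th to the `(s - t)`-th Sobolev norm,
i.e. it extends to a bounded operator between the completions `H^s → H^(s - t)`. -/
def IsOp (r : ℕ) (t : ℝ) (T : Module.End ℂ Δ.Hinf) : Prop :=
  ∀ s : ℝ, ∃ C : ℝ, ∀ v : Δ.Hinf, Δ.sobolevNorm r (s - t) (T v) ≤ C * Δ.sobolevNorm r s v

end AbstractLaplacian

/-! ### Filtered algebras of operators -/

/-- An algebra of linear operators on `V` (not required to contain the identity) with an exhaustive
increasing filtration indexed by `ι`. -/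
structure FilteredOperatorAlgebra (ι : Type*) [AddMonoid ι] [Preorder ι]
    (V : Type*) [AddCommGroup V] [Module ℂ V] where
  alg : NonUnitalSubalgebra ℂ (Module.End ℂ V)
  filt : ι → Submodule ℂ (Module.End ℂ V)
  filt_mono : Monotone filt
  mul_mem : ∀ i j : ι, ∀ X ∈ filt i, ∀ Y ∈ filt j, X * Y ∈ filt (i + j)
  exhaustive : ∀ X : Module.End ℂ V, X ∈ alg ↔ ∃ i, X ∈ filt i

section TwistedAlgebras

variable {H : Type*} [NormedAddCommGroup H] [InnerProductSpace ℂ H] [CompleteSpace H]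

/-- A twisted algebra of abstract differential operators associated to `Δ` (of order `r`). -/
structure TwistedDO (Δ : AbstractLaplacian H) (r : ℕ) extends
    FilteredOperatorAlgebra ℕ Δ.Hinf where
  /-- the twisting, a linear automorphism -/
  θ : alg ≃ₗ[ℂ] alg
  /-- the twisting preserves the filtration: `θ (𝒟^m) = 𝒟^m` -/
  θ_mem_filt : ∀ (m : ℕ) (X : alg),
    (θ X : Module.End ℂ Δ.Hinf) ∈ filt m ↔ (X : Module.End ℂ Δ.Hinf) ∈ filt m
  /-- `Δ X - θ^r(X) Δ ∈ 𝒟^(m + r - 1)` for `X ∈ 𝒟^m` -/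
  twisted_commutator : ∀ (m : ℕ) (X : alg), (X : Module.End ℂ Δ.Hinf) ∈ filt m →
    Δ.lap * (X : Module.End ℂ Δ.Hinf) - ((θ ^ r) X : Module.End ℂ Δ.Hinf) * Δ.lap
      ∈ filt (m + r - 1)
  /-- `‖X v‖ ≤ C ‖Δ^(m/r) v‖` for `X ∈ 𝒟^m` -/
  elliptic_estimate : ∀ (m : ℕ), ∀ X ∈ filt m, ∃ C : ℝ, 0 < C ∧ ∀ v : Δ.Hinf,
    ‖X v‖ ≤ C * ‖Δ.cpow ((m : ℂ) / r) v‖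

/-- A twisted algebra of abstract pseudodifferential operators. -/
structure TwistedPsiDO (Δ : AbstractLaplacian H) (r : ℕ) extends
    FilteredOperatorAlgebra ℝ Δ.Hinf where
  /-- `Ψ ⊆ Op` -/
  isOp : ∀ P ∈ alg, ∃ t : ℝ, Δ.IsOp r t P
  /-- the twisting, a family of algebra automorphisms `Θ^z` -/
  Θ : ℂ → (alg ≃ₗ[ℂ] alg)
  Θ_mul : ∀ (z : ℂ) (P Q : alg), Θ z (P * Q) = Θ z P * Θ z Q
  /-- the twisting preserves the filtration: `Θ^z (Ψ^t) = Ψ^t` -/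
  Θ_mem_filt : ∀ (z : ℂ) (t : ℝ) (P : alg),
    (Θ z P : Module.End ℂ Δ.Hinf) ∈ filt t ↔ (P : Module.End ℂ Δ.Hinf) ∈ filt t
  /-- `Δ^(z/r) Ψ^t ⊆ Ψ^(Re z + t)` -/
  cpow_mul_mem : ∀ (z : ℂ) (t : ℝ), ∀ P ∈ filt t, Δ.cpow (z / r) * P ∈ filt (z.re + t)
  /-- `Ψ^t Δ^(z/r) ⊆ Ψ^(Re z + t)` -/
  mul_cpow_mem : ∀ (z : ℂ) (t : ℝ), ∀ P ∈ filt t, P * Δ.cpow (z / r) ∈ filt (z.re + t)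
  /-- `Δ^(z/r) P - Θ^z(P) Δ^(z/r) ∈ Ψ^(Re z + t - 1)` for `P ∈ Ψ^t` -/
  twisted_commutator : ∀ (z : ℂ) (t : ℝ) (P : alg), (P : Module.End ℂ Δ.Hinf) ∈ filt t →
    Δ.cpow (z / r) * (P : Module.End ℂ Δ.Hinf) - (Θ z P : Module.End ℂ Δ.Hinf) * Δ.cpow (z / r)
      ∈ filt (z.re + t - 1)
  /-- `Ψ^0 ⊆ Op^0` -/
  isOp_zero : ∀ P ∈ filt 0, Δ.IsOp r 0 P

/-- A twisted algebra of abstract pseudodifferential operators of order at most zero. -/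
structure TwistedPsiDO₀ (Δ : AbstractLaplacian H) (r : ℕ) where
  alg : NonUnitalSubalgebra ℂ (Module.End ℂ Δ.Hinf)
  /-- the operators are bounded for the norm of `H` -/
  bounded : ∀ b ∈ alg, ∃ C : ℝ, ∀ v : Δ.Hinf, ‖b v‖ ≤ C * ‖v‖
  /-- the twisting, a linear automorphism -/
  θ : alg ≃ₗ[ℂ] alg
  /-- closure under `δ_θ(b) = Δ^(1/r) b - θ(b) Δ^(1/r)` -/
  twisted_derivation : ∀ b : alg,
    Δ.cpow (1 / r) * (b : Module.End ℂ Δ.Hinf) - (θ b : Module.End ℂ Δ.Hinf) * Δ.cpow (1 / r) ∈ alg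

variable {Δ : AbstractLaplacian H} {r : ℕ}

/-- `𝒟` is compatible with `(𝒜, θ)`: `𝒜 ⊆ 𝒟^0` and the twisting of `𝒟` extends `θ`. -/
def TwistedDO.Compatible (𝒟 : TwistedDO Δ r) (𝒜 : NonUnitalSubalgebra ℂ (Module.End ℂ Δ.Hinf))
    (θ : 𝒜 ≃ₗ[ℂ] 𝒜) : Prop :=
  ∀ a : 𝒜, (a : Module.End ℂ Δ.Hinf) ∈ 𝒟.filt 0 ∧
    ∃ h : (a : Module.End ℂ Δ.Hinf) ∈ 𝒟.alg,
      (𝒟.θ ⟨a, h⟩ : Module.End ℂ Δ.Hinf) = (θ a : Module.End ℂ Δ.Hinf)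

/-- `ℬ` is compatible with `(𝒜, θ)`: `𝒜 ⊆ ℬ` and the twisting of `ℬ` extends `θ`. -/
def TwistedPsiDO₀.Compatible (ℬ : TwistedPsiDO₀ Δ r)
    (𝒜 : NonUnitalSubalgebra ℂ (Module.End ℂ Δ.Hinf)) (θ : 𝒜 ≃ₗ[ℂ] 𝒜) : Prop :=
  ∀ a : 𝒜, ∃ h : (a : Module.End ℂ Δ.Hinf) ∈ ℬ.alg,
    (ℬ.θ ⟨a, h⟩ : Module.End ℂ Δ.Hinf) = (θ a : Module.End ℂ Δ.Hinf)

/-- `Ψ` is compatible with `(𝒜, θ)`: `𝒜 ⊆ Ψ^0` and `Θ^1(a) - θ(a) ∈ Ψ^(-1)` for `a ∈ 𝒜`. -/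
def TwistedPsiDO.Compatible (Ψ : TwistedPsiDO Δ r)
    (𝒜 : NonUnitalSubalgebra ℂ (Module.End ℂ Δ.Hinf)) (θ : 𝒜 ≃ₗ[ℂ] 𝒜) : Prop :=
  ∀ a : 𝒜, (a : Module.End ℂ Δ.Hinf) ∈ Ψ.filt 0 ∧
    ∃ h : (a : Module.End ℂ Δ.Hinf) ∈ Ψ.alg,
      (Ψ.Θ 1 ⟨a, h⟩ : Module.End ℂ Δ.Hinf) - (θ a : Module.End ℂ Δ.Hinf) ∈ Ψ.filt (-1)

/-- `f` is diagonalizable: the space is the algebraic direct sum of the eigenspaces of `f`. -/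
def IsDiagonalizableEnd {V : Type*} [AddCommGroup V] [Module ℂ V] (f : Module.End ℂ V) : Prop :=
  iSupIndep (fun μ : ℂ => Module.End.eigenspace f μ) ∧ ⨆ μ : ℂ, Module.End.eigenspace f μ = ⊤

/-- The spectrum of `f` consists of positive real numbers. -/
def HasPositiveSpectrum {V : Type*} [AddCommGroup V] [Module ℂ V] (f : Module.End ℂ V) : Prop :=
  ∀ μ ∈ spectrum ℂ f, ∃ c : ℝ, 0 < c ∧ μ = c

/-- The operators `X Δ^((z - m)/r)` with `X ∈ 𝒟^m` and `Re z ≤ t`. -/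
def TwistedDO.basicOperators (𝒟 : TwistedDO Δ r) (t : ℝ) : Set (Module.End ℂ Δ.Hinf) :=
  {P | ∃ (m : ℕ) (z : ℂ), ∃ X ∈ 𝒟.filt m, z.re ≤ t ∧ P = X * Δ.cpow ((z - m) / r)}

end TwistedAlgebras

namespace AbstractLaplacian

variable {H : Type*} [NormedAddCommGroup H] [InnerProductSpace ℂ H] [CompleteSpace H]
variable (Δ : AbstractLaplacian H)

/-! ### Functional calculus of the bounded inverse on smooth vectors -/

/-! Parts 1 and 2 rest on one piece of linear algebra, `LinearEquiv.exists_extend_modulo`: a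
twisting that agrees on `𝒜` with a natural automorphism only up to lower order can be corrected,
within that lower order, to extend `θ` exactly. Since the twistings of `ℬ` and `𝒟` need only be
linear, the correction is allowed. For part 1 take `ℬ = Ψ^0` and correct `Θ^1` modulo `Ψ^(-1)`. For
part 2 take for `𝒟^m` all operators of order at most `m` between Sobolev spaces of integral degree,
and correct conjugation by `Δ^(1/r)` modulo order `-1`. The link with `θ` is
`TwistedPsiDO₀.alg_le_intOp`: closure of `ℬ` under `θ`, `θ⁻¹` and the twisted derivation propagates
boundedness on `H` to every integral Sobolev degree.

Part 3 is an asymptotic expansion of `Δ^(-z) X` for `0 < Re z < 1`. Diagonalizability reduces to an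
eigenvector `θ X = ν X` with `ν > 0`. With `μ = ν^r`, the operator `Y = Δ X - μ X Δ` has order one
less than `Δ X`, and `(t + Δ)⁻¹ X = X (t + μ Δ)⁻¹ - (t + Δ)⁻¹ Y (t + μ Δ)⁻¹`. Repeating this on `Y`
pushes resolvents to the right; each round raises the differential order by `r - 1` and adds a
resolvent of order `-r`, so the remainder drops by one. Integration against `t^(-z)` turns `(t +
Δ)⁻¹` into a nonzero multiple of `Δ^(-z)`, and by homogeneity turns `n + 1` resolvents into a
multiple of `Δ^(-z-n)`. This is `TwistedDO.IsEigen.exists_cpow_neg_mul`, with leading term `μ^(-z) X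
Δ^(-z)`. Positivity of the spectrum keeps `t + μ Δ` invertible.

Estimating the remainder in a Sobolev degree requires `𝒟` to be bounded there. This is a bootstrap
(`TwistedDO.boundedAt`): degree `0` is the elliptic estimate, the commutator relation moves up by
`r`, and the expansion at one degree moves down by any amount less than `r`. Then the operators with
expansions in basic operators form an algebra stable under both multiplications by complex powers;
exact conjugation is its twisting. Compatibility with `θ` is the leading term at `z = 1 - 1/r`,
where `μ^(-z) μ = ν`. -/

instance isStarNormal_inv : IsStarNormal Δ.inv := Δ.isSelfAdjoint_inv.isStarNormal

theorem isPositive_inv : Δ.inv.IsPositive := by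
  refine ⟨ContinuousLinearMap.isSelfAdjoint_iff_isSymmetric.1 Δ.isSelfAdjoint_inv, fun x => ?_⟩
  obtain ⟨ε, hε, h⟩ := Δ.strictlyPositive
  have h1 := h ⟨Δ.inv x, Δ.inv_mem_domain x⟩
  rw [Δ.op_inv] at h1
  exact (by positivity : (0 : ℝ) ≤ ε * ‖Δ.inv x‖ ^ 2).trans h1

theorem exists_of_mem_spectrum {x : ℂ} (hx : x ∈ spectrum ℂ Δ.inv) :
    ∃ y : ℝ, 0 ≤ y ∧ y ≤ ‖Δ.inv‖ ∧ x = y := by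
  have h1 : x = x.re := Δ.isSelfAdjoint_inv.mem_spectrum_eq_re hx
  have h0 : (0 : H →L[ℂ] H) ≤ Δ.inv :=
    (ContinuousLinearMap.nonneg_iff_isPositive _).2 Δ.isPositive_inv
  refine ⟨x.re, ?_, ?_, h1⟩
  · refine spectrum_nonneg_of_nonneg (𝕜 := ℝ) h0 ?_
    rw [← spectrum.algebraMap_mem_iff ℂ]
    rw [h1] at hx
    simpa using hx
  · rcases subsingleton_or_nontrivial H with hH | hH
    · have : Subsingleton (H →L[ℂ] H) := inferInstance
      simp [spectrum.of_subsingleton] at hx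
    · exact (Complex.re_le_norm x).trans (spectrum.norm_le_norm_of_mem hx)

/-- The operator `f (Δ⁻¹)` on `H^∞`. -/
noncomputable def fc (f : ℂ → ℂ) : Module.End ℂ Δ.Hinf :=
  (cfc f Δ.inv).toLinearMap.restrict
    (fun _ hx => Δ.map_mem_Hinf (Δ.isSelfAdjoint_inv.commute_cfc (Commute.refl _) f) hx)

theorem coe_fc (f : ℂ → ℂ) (v : Δ.Hinf) : (Δ.fc f v : H) = cfc f Δ.inv (v : H) := rfl

theorem fc_mul {f g : ℂ → ℂ} (hf : ContinuousOn f (spectrum ℂ Δ.inv))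
    (hg : ContinuousOn g (spectrum ℂ Δ.inv)) :
    Δ.fc (fun x => f x * g x) = Δ.fc f * Δ.fc g := by
  ext v
  rw [coe_fc, cfc_mul f g Δ.inv hf hg]
  rfl

theorem fc_congr {f g : ℂ → ℂ} (h : ∀ x ∈ spectrum ℂ Δ.inv, f x = g x) : Δ.fc f = Δ.fc g := by
  ext v
  rw [coe_fc, cfc_congr (g := g) h]
  rfl

theorem commute_fc (f g : ℂ → ℂ) : Commute (Δ.fc f) (Δ.fc g) := by
  ext v
  exact congrArg (fun T : H →L[ℂ] H => T v) (cfc_commute_cfc f g Δ.inv).eq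

theorem norm_fc_le {f : ℂ → ℂ} {c : ℝ} (hc : 0 ≤ c) (h : ∀ x ∈ spectrum ℂ Δ.inv, ‖f x‖ ≤ c)
    (v : Δ.Hinf) : ‖Δ.fc f v‖ ≤ c * ‖v‖ :=
  ((cfc f Δ.inv).le_opNorm v).trans
    (mul_le_mul_of_nonneg_right (norm_cfc_le hc h) (norm_nonneg _))

theorem fc_id : Δ.fc (fun x => x) * Δ.lap = 1 := by
  ext v
  change cfc (fun x : ℂ => x) Δ.inv (Δ.op ⟨v, _⟩) = v
  rw [cfc_id' ℂ Δ.inv]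
  exact Δ.inv_op ⟨v, _⟩

theorem lap_mul_fc_id : Δ.lap * Δ.fc (fun x => x) = 1 := by
  ext v
  change Δ.op ⟨cfc (fun x : ℂ => x) Δ.inv (v : H), _⟩ = v
  have h : cfc (fun x : ℂ => x) Δ.inv (v : H) = Δ.inv v := by rw [cfc_id' ℂ Δ.inv]
  simp only [h]
  exact Δ.op_inv v

/-- On `H^∞` the operator `Δ` is a two-sided inverse of `Δ⁻¹`, with which every `f (Δ⁻¹)` commutes.
-/
theorem commute_fc_lap (f : ℂ → ℂ) : Commute (Δ.fc f) Δ.lap := by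
  have h := (Δ.commute_fc f (fun x => x)).eq
  calc Δ.fc f * Δ.lap = Δ.lap * Δ.fc (fun x => x) * (Δ.fc f * Δ.lap) := by
        rw [lap_mul_fc_id, one_mul]
    _ = Δ.lap * (Δ.fc f * Δ.fc (fun x => x)) * Δ.lap := by rw [h]; noncomm_ring
    _ = Δ.lap * Δ.fc f * (Δ.fc (fun x => x) * Δ.lap) := by noncomm_ring
    _ = Δ.lap * Δ.fc f := by rw [fc_id, mul_one]

/-! ### The group of complex powers -/

/-- The spectrum of `Δ⁻¹` may contain `0` when `Δ` is unbounded; `0 < Re w` gives continuity there.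
-/
theorem continuousOn_cpow {w : ℂ} (hw : 0 < w.re) :
    ContinuousOn (fun x : ℂ => x ^ w) (spectrum ℂ Δ.inv) := by
  intro x hx
  obtain ⟨y, hy, -, rfl⟩ := Δ.exists_of_mem_spectrum hx
  exact (Complex.continuousAt_cpow_const_of_re_pos (Or.inl (by simpa using hy))
    hw).continuousWithinAt

/-- The bounded negative powers `Δ ^ (-w)` on `H^∞`. -/
noncomputable def npow (w : ℂ) : Module.End ℂ Δ.Hinf := Δ.fc (fun x => x ^ w)

theorem npow_add {w w' : ℂ} (hw : 0 < w.re) (hw' : 0 < w'.re) :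
    Δ.npow (w + w') = Δ.npow w * Δ.npow w' := by
  rw [npow, npow, npow, ← Δ.fc_mul (Δ.continuousOn_cpow hw) (Δ.continuousOn_cpow hw')]
  refine Δ.fc_congr fun x _ => ?_
  rcases eq_or_ne x 0 with rfl | h
  · rw [Complex.zero_cpow, Complex.zero_cpow, zero_mul]
    · rintro rfl; simp at hw
    · intro h
      have := congrArg Complex.re h
      simp at this
      linarith
  · exact Complex.cpow_add _ _ h

theorem npow_one : Δ.npow 1 = Δ.fc (fun x => x) := Δ.fc_congr fun x _ => Complex.cpow_one x

theorem npow_one_mul_lap : Δ.npow 1 * Δ.lap = 1 := by rw [npow_one, fc_id]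

theorem npow_succ_mul_lap_pow {w : ℂ} (hw : 0 < w.re) (n k : ℕ) :
    Δ.npow (w + k) * Δ.lap ^ (n + k) = Δ.npow w * Δ.lap ^ n := by
  induction k with
  | zero => simp
  | succ k ih =>
    have h : 0 < (w + k).re := by simp; positivity
    rw [show w + ((k + 1 : ℕ) : ℂ) = (w + k) + 1 by push_cast; ring, Δ.npow_add h (by simp),
      ← add_assoc, pow_succ', mul_assoc, ← mul_assoc (Δ.npow 1), npow_one_mul_lap, one_mul, ih]

theorem cpow_eq {z : ℂ} {n : ℕ} (hn : z.re < n) : Δ.cpow z = Δ.npow (n - z) * Δ.lap ^ n := by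
  have h0 : 0 < (((⌈z.re⌉₊ + 1 : ℕ) : ℂ) - z).re := by
    have := Nat.le_ceil z.re
    simp
    linarith
  have h1 : 0 < ((n : ℂ) - z).re := by simpa using hn
  change Δ.npow (((⌈z.re⌉₊ + 1 : ℕ) : ℂ) - z) * Δ.lap ^ (⌈z.re⌉₊ + 1) = _
  -- Both expressions are rewritten with the same larger power of `Δ.lap`, the sum of the two
  -- exponents.
  rw [← Δ.npow_succ_mul_lap_pow h0 _ n, ← Δ.npow_succ_mul_lap_pow h1 n (⌈z.re⌉₊ + 1), add_comm n]
  congr 2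
  ring

theorem cpow_neg_eq {w : ℂ} (hw : 0 < w.re) : Δ.cpow (-w) = Δ.npow w := by
  rw [Δ.cpow_eq (n := 0) (by simpa using hw)]
  simp

theorem cpow_add (z w : ℂ) : Δ.cpow (z + w) = Δ.cpow z * Δ.cpow w := by
  obtain ⟨n, hn⟩ := exists_nat_gt z.re
  obtain ⟨k, hk⟩ := exists_nat_gt w.re
  rw [Δ.cpow_eq hn, Δ.cpow_eq hk, Δ.cpow_eq (n := n + k) (by simp; linarith),
    show ((n + k : ℕ) : ℂ) - (z + w) = (n - z) + (k - w) by push_cast; ring,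
    Δ.npow_add (by simpa using hn) (by simpa using hk), pow_add]
  have h := ((Δ.commute_fc_lap (fun x => x ^ ((k : ℂ) - w))).pow_right n).eq
  change Δ.npow _ * _ = _ * Δ.npow _ at h
  rw [mul_assoc, ← mul_assoc (Δ.npow (k - w)), h]
  noncomm_ring

theorem cpow_zero : Δ.cpow 0 = 1 := by
  rw [Δ.cpow_eq (n := 1) (by simp)]
  simpa using Δ.npow_one_mul_lap

theorem cpow_one : Δ.cpow 1 = Δ.lap := by
  rw [Δ.cpow_eq (n := 2) (by simp), pow_two, ← mul_assoc]
  norm_num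
  rw [npow_one_mul_lap, one_mul]

theorem cpow_cpow_apply (z w : ℂ) (v : Δ.Hinf) : Δ.cpow z (Δ.cpow w v) = Δ.cpow (z + w) v := by
  rw [cpow_add]; rfl

theorem commute_fc_cpow (f : ℂ → ℂ) (z : ℂ) : Commute (Δ.fc f) (Δ.cpow z) := by
  obtain ⟨n, hn⟩ := exists_nat_gt z.re
  rw [Δ.cpow_eq hn]
  exact (Δ.commute_fc _ _).mul_right ((Δ.commute_fc_lap f).pow_right n)

theorem adjoint_cfc_mul_cfc {f : ℂ → ℂ} (hf : ContinuousOn f (spectrum ℂ Δ.inv)) :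
    star (cfc f Δ.inv) * cfc f Δ.inv = cfc (fun x => star (f x) * f x) Δ.inv := by
  rw [cfc_mul _ _ Δ.inv hf.star hf, cfc_star]

theorem norm_sq_cfc_apply {f : ℂ → ℂ} (hf : ContinuousOn f (spectrum ℂ Δ.inv)) (x : H) :
    ((‖cfc f Δ.inv x‖ ^ 2 : ℝ) : ℂ) = ⟪x, cfc (fun x => star (f x) * f x) Δ.inv x⟫_ℂ := by
  have h : ∀ T : H →L[ℂ] H, ((‖T x‖ ^ 2 : ℝ) : ℂ) = ⟪x, (star T * T) x⟫_ℂ := by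
    intro T
    change _ = ⟪x, ContinuousLinearMap.adjoint T (T x)⟫_ℂ
    rw [ContinuousLinearMap.adjoint_inner_right, inner_self_eq_norm_sq_to_K]
    simp
  rw [← Δ.adjoint_cfc_mul_cfc hf]
  exact h _

theorem norm_cfc_apply_eq {f g : ℂ → ℂ} (hf : ContinuousOn f (spectrum ℂ Δ.inv))
    (hg : ContinuousOn g (spectrum ℂ Δ.inv)) (h : ∀ x ∈ spectrum ℂ Δ.inv, ‖f x‖ = ‖g x‖) (x : H) :
    ‖cfc f Δ.inv x‖ = ‖cfc g Δ.inv x‖ := by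
  have e : cfc (fun x => star (f x) * f x) Δ.inv = cfc (fun x => star (g x) * g x) Δ.inv := by
    refine cfc_congr fun x hx => ?_
    simp only [Complex.star_def, ← Complex.normSq_eq_conj_mul_self, Complex.normSq_eq_norm_sq,
      h x hx]
  have h3 := Δ.norm_sq_cfc_apply hf x
  rw [e, ← Δ.norm_sq_cfc_apply hg x] at h3
  have h2 : ‖cfc f Δ.inv x‖ ^ 2 = ‖cfc g Δ.inv x‖ ^ 2 := by exact_mod_cast h3
  exact (sq_eq_sq₀ (norm_nonneg _) (norm_nonneg _)).1 h2

/-- For `x ≥ 0` the modulus of `x ^ w` depends only on `Re w`, and `‖f (Δ⁻¹) v‖` depends only on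
`|f|` by `norm_cfc_apply_eq`. Imaginary powers thus act isometrically. -/
theorem norm_npow_eq {w w' : ℂ} (hw : 0 < w.re) (h : w.re = w'.re) (v : Δ.Hinf) :
    ‖Δ.npow w v‖ = ‖Δ.npow w' v‖ := by
  refine Δ.norm_cfc_apply_eq (Δ.continuousOn_cpow hw) (Δ.continuousOn_cpow (h ▸ hw)) ?_ _
  intro x hx
  obtain ⟨y, hy, -, rfl⟩ := Δ.exists_of_mem_spectrum hx
  rcases hy.eq_or_lt with rfl | hy
  · rw [Complex.ofReal_zero, Complex.zero_cpow, Complex.zero_cpow]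
    · rintro rfl; simp at h; linarith
    · rintro rfl; simp at hw
  · rw [Complex.norm_cpow_eq_rpow_re_of_pos hy, Complex.norm_cpow_eq_rpow_re_of_pos hy, h]

theorem norm_cpow_eq {z z' : ℂ} (h : z.re = z'.re) (v : Δ.Hinf) : ‖Δ.cpow z v‖ = ‖Δ.cpow z' v‖ := by
  obtain ⟨n, hn⟩ := exists_nat_gt z.re
  rw [Δ.cpow_eq hn, Δ.cpow_eq (h ▸ hn : z'.re < n)]
  exact Δ.norm_npow_eq (by simpa using hn) (by simp [h]) _

theorem exists_norm_cpow_le {z w : ℂ} (h : z.re ≤ w.re) :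
    ∃ C : ℝ, 0 < C ∧ ∀ v : Δ.Hinf, ‖Δ.cpow z v‖ ≤ C * ‖Δ.cpow w v‖ := by
  rcases h.eq_or_lt with h | h
  · exact ⟨1, one_pos, fun v => by rw [one_mul, Δ.norm_cpow_eq h]⟩
  · refine ⟨‖cfc (fun x : ℂ => x ^ (w - z)) Δ.inv‖ + 1, by positivity, fun v => ?_⟩
    have h1 : Δ.cpow z v = Δ.npow (w - z) (Δ.cpow w v) := by
      rw [← Δ.cpow_neg_eq (by simpa using h), cpow_cpow_apply]
      congr 2
      ring
    rw [h1]
    refine ((cfc (fun x : ℂ => x ^ (w - z)) Δ.inv).le_opNorm _).trans ?_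
    refine mul_le_mul_of_nonneg_right (by linarith) (norm_nonneg _)

theorem inner_lap (v w : Δ.Hinf) : ⟪Δ.lap v, w⟫_ℂ = ⟪v, Δ.lap w⟫_ℂ := by
  have hfa := LinearPMap.adjoint_isFormalAdjoint Δ.selfAdjoint.dense_domain
  rw [show Δ.op.adjoint = Δ.op from Δ.selfAdjoint] at hfa
  exact hfa ⟨v, Δ.Hinf_le_domain v.2⟩ ⟨w, Δ.Hinf_le_domain w.2⟩

theorem inner_lap_pow (n : ℕ) (v w : Δ.Hinf) :
    ⟪(Δ.lap ^ n) v, w⟫_ℂ = ⟪v, (Δ.lap ^ n) w⟫_ℂ := by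
  induction n generalizing v w with
  | zero => rfl
  | succ n ih =>
    rw [pow_succ', Module.End.mul_apply, inner_lap, ih, ← Module.End.mul_apply, ← pow_succ,
      pow_succ']

theorem inner_cpow_ofReal (a : ℝ) (v w : Δ.Hinf) :
    ⟪Δ.cpow a v, w⟫_ℂ = ⟪v, Δ.cpow a w⟫_ℂ := by
  obtain ⟨n, hn⟩ := exists_nat_gt a
  have hsa : IsSelfAdjoint (cfc (fun x : ℂ => x ^ ((n : ℂ) - a)) Δ.inv) := by
    have h : 0 < ((n : ℂ) - a).re := by simpa using hn
    rw [isSelfAdjoint_iff, ← cfc_star]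
    refine cfc_congr fun x hx => ?_
    obtain ⟨y, hy, -, rfl⟩ := Δ.exists_of_mem_spectrum hx
    simp only [Complex.star_def]
    rw [show (n : ℂ) - a = ((n - a : ℝ) : ℂ) by push_cast; rfl, ← Complex.ofReal_cpow hy,
      Complex.conj_ofReal]
  have hs := ContinuousLinearMap.isSelfAdjoint_iff_isSymmetric.1 hsa
  rw [Δ.cpow_eq (n := n) (by simpa using hn)]
  have hcomm := ((Δ.commute_fc_lap (fun x => x ^ ((n : ℂ) - a))).pow_right n).eq
  change Δ.npow _ * _ = _ * Δ.npow _ at hcomm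
  conv_rhs => rw [hcomm, Module.End.mul_apply, ← inner_lap_pow]
  exact hs _ _

end AbstractLaplacian

/-! ### Perturbing linear automorphisms -/

section LinearAlgebra

variable {K : Type*} [Field K] {A V : Type*} [AddCommGroup A] [Module K A] [AddCommGroup V]
  [Module K V]

/-- An automorphism of a subspace extends to the whole space. -/
theorem LinearEquiv.exists_extend_of_injective {j : A →ₗ[K] V} (hj : Function.Injective j)
    (θ : A ≃ₗ[K] A) : ∃ ψ : V ≃ₗ[K] V, ∀ a, ψ (j a) = j (θ a) := by
  obtain ⟨C, hC⟩ := Submodule.exists_isCompl (LinearMap.range j)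
  let e : (A × C) ≃ₗ[K] V :=
    ((LinearEquiv.ofInjective j hj).prodCongr (LinearEquiv.refl K C)).trans
      (Submodule.prodEquivOfIsCompl _ C hC)
  have he : ∀ a, e (a, 0) = j a := fun a => by simp [e]
  refine ⟨(e.symm.trans (θ.prodCongr (LinearEquiv.refl K C))).trans e, fun a => ?_⟩
  rw [← he, ← he]
  simp

/-- A linear map on a subspace, given through a parametrization of that subspace, extends. -/
theorem LinearMap.exists_comp_eq_of_ker_le {W : Type*} [AddCommGroup W] [Module K W]
    (s : A →ₗ[K] V) (f : A →ₗ[K] W) (h : ∀ a, s a = 0 → f a = 0) :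
    ∃ L : V →ₗ[K] W, ∀ a, L (s a) = f a := by
  obtain ⟨g, hg⟩ := s.rangeRestrict.exists_rightInverse_of_surjective
    (LinearMap.range_eq_top.2 s.surjective_rangeRestrict)
  obtain ⟨L, hL⟩ := (f ∘ₗ g).exists_extend
  refine ⟨L, fun a => ?_⟩
  have h1 : L (s a) = f (g (s.rangeRestrict a)) := by
    rw [← LinearMap.comp_apply f g, ← hL]
    rfl
  have h2 : s (g (s.rangeRestrict a)) = s a :=
    congrArg Subtype.val (LinearMap.congr_fun hg (s.rangeRestrict a))
  have h3 := h (g (s.rangeRestrict a) - a) (by rw [map_sub, h2, sub_self])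
  rw [map_sub, sub_eq_zero] at h3
  rw [h1, h3]

/-- Let `φ` be an automorphism of `V` preserving `W`, and `θ` an automorphism of a subspace `A`
which agrees with `φ` modulo `W`. Then `θ` extends to an automorphism of `V` which agrees with `φ`
modulo `W`. -/
theorem LinearEquiv.exists_extend_modulo (W : Submodule K V) (φ : V ≃ₗ[K] V)
    (hφ : ∀ x, φ x ∈ W ↔ x ∈ W) {i : A →ₗ[K] V} (hi : Function.Injective i) (θ : A ≃ₗ[K] A)
    (hθ : ∀ a, i (θ a) - φ (i a) ∈ W) :
    ∃ ψ : V ≃ₗ[K] V, (∀ x, ψ x - φ x ∈ W) ∧ ∀ a, ψ (i a) = i (θ a) := by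
  have hθW : ∀ a, i (θ a) ∈ W ↔ i a ∈ W := fun a => by
    rw [← hφ (i a)]
    exact ⟨fun h => by simpa using W.sub_mem h (hθ a), fun h => by simpa using W.add_mem (hθ a) h⟩
  -- Because `θ` agrees with `φ` modulo `W` and `φ` preserves `W`, `θ` restricts to an automorphism
  -- of `A ∩ W`; it is extended to an automorphism `ψ₁` of `W`.
  let θ₁ : W.comap i ≃ₗ[K] W.comap i :=
    { toFun := fun a => ⟨θ a, (hθW a).2 a.2⟩
      invFun := fun a => ⟨θ.symm a, (hθW _).1 (by
        rw [LinearEquiv.apply_symm_apply]; exact a.2)⟩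
      map_add' := fun a b => Subtype.ext (by simp)
      map_smul' := fun c a => Subtype.ext (by simp)
      left_inv := fun a => Subtype.ext (by simp)
      right_inv := fun a => Subtype.ext (by simp) }
  obtain ⟨ψ₁, hψ₁⟩ := LinearEquiv.exists_extend_of_injective
    (j := i.restrict (p := W.comap i) (q := W) fun _ h => h)
    (fun a b h => Subtype.ext (hi (congrArg Subtype.val h))) θ₁
  have hψ₁' : ∀ (a : A) (ha : i a ∈ W), (ψ₁ ⟨i a, ha⟩ : V) = i (θ a) := fun a ha =>
    congrArg Subtype.val (hψ₁ ⟨a, ha⟩)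
  let f₁ : A →ₗ[K] W :=
    (i ∘ₗ θ.toLinearMap - φ.toLinearMap ∘ₗ i).codRestrict W hθ
  let f₂ : W →ₗ[K] W :=
    (W.subtype ∘ₗ ψ₁.toLinearMap - φ.toLinearMap ∘ₗ W.subtype).codRestrict W
      (fun w => W.sub_mem (ψ₁ w).2 ((hφ _).2 w.2))
  -- The correction `L : V → W` is prescribed as `θ - φ` on `A` and as `ψ₁ - φ` on `W`. The two
  -- agree on `A ∩ W`, so `L` exists on `A + W` and extends to `V`.
  obtain ⟨L, hL⟩ := LinearMap.exists_comp_eq_of_ker_le (i.coprod W.subtype) (f₁.coprod f₂) (by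
    rintro ⟨a, w⟩ h
    have h' : i a = ((-w : W) : V) := by
      simpa [eq_neg_iff_add_eq_zero] using h
    have ha : i a ∈ W := h' ▸ (-w).2
    have hw : w = -⟨i a, ha⟩ := by
      rw [← neg_eq_iff_eq_neg]
      exact Subtype.ext h'.symm
    subst hw
    apply Subtype.ext
    simp [f₁, f₂, hψ₁'])
  have hLi : ∀ a, (L (i a) : V) = i (θ a) - φ (i a) := fun a => by
    simpa [f₁] using congrArg Subtype.val (hL (a, 0))
  have hLW : ∀ w : W, (L w : V) = ψ₁ w - φ w := fun w => by
    simpa [f₂] using congrArg Subtype.val (hL (0, w))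
  let ψ : V →ₗ[K] V := φ.toLinearMap + W.subtype ∘ₗ L
  have hψ : ∀ x, ψ x = φ x + L x := fun _ => rfl
  have hψW : ∀ w : W, ψ w = ψ₁ w := fun w => by rw [hψ, hLW]; abel
  -- `ψ = φ + L` induces `φ` on `V / W` and `ψ₁` on `W`, both bijective.
  have hbij : Function.Bijective ψ := by
    constructor
    · rw [injective_iff_map_eq_zero]
      intro x hx
      have hxW : x ∈ W := by
        have h1 : φ x = ((-L x : W) : V) := eq_neg_of_add_eq_zero_left hx
        rw [← hφ, h1]
        exact (-L x).2
      have h1 : (ψ₁ ⟨x, hxW⟩ : V) = 0 := (hψW ⟨x, hxW⟩).symm.trans hx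
      simpa using h1
    · intro y
      let w : W := ψ₁.symm (-L (φ.symm y))
      refine ⟨φ.symm y + w, ?_⟩
      rw [map_add, hψW, hψ]
      simp [w]
  exact ⟨LinearEquiv.ofBijective ψ hbij, fun x => by simp [hψ], fun a => by simp [hψ, hLi]⟩

end LinearAlgebra

namespace AbstractLaplacian

variable {H : Type*} [NormedAddCommGroup H] [InnerProductSpace ℂ H] [CompleteSpace H]
variable (Δ : AbstractLaplacian H) (r : ℕ)

/-! ### Powers of `Δ^(1/r)` -/

/-- The powers of `Δ^(1/r)`. -/
noncomputable def dpow (z : ℂ) : Module.End ℂ Δ.Hinf := Δ.cpow (z / r)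

theorem dpow_add (z w : ℂ) : Δ.dpow r (z + w) = Δ.dpow r z * Δ.dpow r w := by
  rw [dpow, add_div, cpow_add]; rfl

theorem dpow_zero : Δ.dpow r 0 = 1 := by rw [dpow, zero_div, cpow_zero]

theorem dpow_dpow_apply (z w : ℂ) (v : Δ.Hinf) :
    Δ.dpow r z (Δ.dpow r w v) = Δ.dpow r (z + w) v := by
  rw [dpow_add]; rfl

theorem dpow_mul_dpow (z w : ℂ) : Δ.dpow r z * Δ.dpow r w = Δ.dpow r (z + w) :=
  (Δ.dpow_add r z w).symm

theorem dpow_mul_neg (z : ℂ) : Δ.dpow r z * Δ.dpow r (-z) = 1 := by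
  rw [dpow_mul_dpow, add_neg_cancel, dpow_zero]

theorem dpow_neg_mul (z : ℂ) : Δ.dpow r (-z) * Δ.dpow r z = 1 := by
  rw [dpow_mul_dpow, neg_add_cancel, dpow_zero]

variable {r}

theorem dpow_mul_nat (hr : r ≠ 0) (z : ℂ) : Δ.dpow r (r * z) = Δ.cpow z := by
  rw [dpow, mul_div_cancel_left₀ _ (Nat.cast_ne_zero.2 hr)]

theorem dpow_self (hr : r ≠ 0) : Δ.dpow r r = Δ.lap := by
  rw [← mul_one (r : ℂ), dpow_mul_nat Δ hr, cpow_one]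

variable (r)

theorem exists_norm_dpow_le {z w : ℂ} (h : z.re ≤ w.re) :
    ∃ C : ℝ, 0 < C ∧ ∀ v : Δ.Hinf, ‖Δ.dpow r z v‖ ≤ C * ‖Δ.dpow r w v‖ :=
  Δ.exists_norm_cpow_le (by
    rw [Complex.div_natCast_re, Complex.div_natCast_re]
    gcongr)

theorem norm_dpow_eq {z w : ℂ} (h : z.re = w.re) (v : Δ.Hinf) :
    ‖Δ.dpow r z v‖ = ‖Δ.dpow r w v‖ :=
  Δ.norm_cpow_eq (by rw [Complex.div_natCast_re, Complex.div_natCast_re, h]) v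

/-- Conjugation by a power of `Δ^(1/r)`. -/
noncomputable def conjPow (z : ℂ) : Module.End ℂ Δ.Hinf ≃ₐ[ℂ] Module.End ℂ Δ.Hinf where
  toFun P := Δ.dpow r z * P * Δ.dpow r (-z)
  invFun P := Δ.dpow r (-z) * P * Δ.dpow r z
  left_inv P := by
    calc _ = (Δ.dpow r (-z) * Δ.dpow r z) * P * (Δ.dpow r (-z) * Δ.dpow r z) := by noncomm_ring
      _ = P := by rw [dpow_neg_mul, one_mul, mul_one]
  right_inv P := by
    calc _ = (Δ.dpow r z * Δ.dpow r (-z)) * P * (Δ.dpow r z * Δ.dpow r (-z)) := by noncomm_ring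
      _ = P := by rw [dpow_mul_neg, one_mul, mul_one]
  map_mul' P Q := by
    calc _ = Δ.dpow r z * P * 1 * Q * Δ.dpow r (-z) := by noncomm_ring
      _ = _ := by rw [← Δ.dpow_neg_mul r z]; noncomm_ring
  map_add' P Q := by noncomm_ring
  commutes' c := by
    rw [← Algebra.commutes, mul_assoc, dpow_mul_neg, mul_one]

theorem conjPow_apply (z : ℂ) (P : Module.End ℂ Δ.Hinf) :
    Δ.conjPow r z P = Δ.dpow r z * P * Δ.dpow r (-z) := rfl

/-! ### Operators of integral analytic order -/

/-- The operators which lower the integral Sobolev degree by at most `m`. -/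
noncomputable def intOp (m : ℤ) : Submodule ℂ (Module.End ℂ Δ.Hinf) where
  carrier := {T | ∀ s : ℤ, ∃ C : ℝ, 0 ≤ C ∧ ∀ v : Δ.Hinf,
    ‖Δ.dpow r (s - m : ℤ) (T v)‖ ≤ C * ‖Δ.dpow r s v‖}
  add_mem' {T U} hT hU s := by
    obtain ⟨C, hC, hT⟩ := hT s
    obtain ⟨C', hC', hU⟩ := hU s
    refine ⟨C + C', by positivity, fun v => ?_⟩
    rw [LinearMap.add_apply, map_add, add_mul]
    exact (norm_add_le _ _).trans (add_le_add (hT v) (hU v))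
  zero_mem' s := ⟨0, le_rfl, fun v => by simp⟩
  smul_mem' c T hT s := by
    obtain ⟨C, hC, hT⟩ := hT s
    refine ⟨‖c‖ * C, by positivity, fun v => ?_⟩
    rw [LinearMap.smul_apply, map_smul, mul_assoc]
    exact (norm_smul_le _ _).trans (mul_le_mul_of_nonneg_left (hT v) (norm_nonneg _))

variable {r}

theorem intOp_mono : Monotone (Δ.intOp r) := by
  intro m n hmn T hT s
  obtain ⟨C, hC, hT⟩ := hT s
  obtain ⟨C', hC', h⟩ := Δ.exists_norm_dpow_le r (z := (s - n : ℤ)) (w := (s - m : ℤ)) (by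
    rw [Complex.intCast_re, Complex.intCast_re]
    exact_mod_cast sub_le_sub_left hmn s)
  refine ⟨C' * C, by positivity, fun v => (h _).trans ?_⟩
  rw [mul_assoc]
  exact mul_le_mul_of_nonneg_left (hT v) hC'.le

theorem mul_mem_intOp {m n : ℤ} {T U : Module.End ℂ Δ.Hinf} (hT : T ∈ Δ.intOp r m)
    (hU : U ∈ Δ.intOp r n) : T * U ∈ Δ.intOp r (m + n) := by
  intro s
  obtain ⟨C, hC, hT⟩ := hT (s - n)
  obtain ⟨C', hC', hU⟩ := hU s
  refine ⟨C * C', by positivity, fun v => ?_⟩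
  rw [show s - (m + n) = s - n - m by ring, mul_assoc]
  exact (hT _).trans (mul_le_mul_of_nonneg_left (hU v) hC)

theorem dpow_mem_intOp (k : ℤ) : Δ.dpow r k ∈ Δ.intOp r k := by
  intro s
  refine ⟨1, zero_le_one, fun v => ?_⟩
  rw [dpow_dpow_apply, one_mul]
  push_cast
  rw [sub_add_cancel]

theorem conjPow_mem_intOp {m : ℤ} (k : ℤ) {T : Module.End ℂ Δ.Hinf} (hT : T ∈ Δ.intOp r m) :
    Δ.conjPow r k T ∈ Δ.intOp r m := by
  have h := Δ.mul_mem_intOp (Δ.mul_mem_intOp (Δ.dpow_mem_intOp k) hT) (Δ.dpow_mem_intOp (-k))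
  rw [show k + m + -k = m by ring] at h
  rw [conjPow_apply]
  exact_mod_cast h

theorem conjPow_mem_intOp_iff {m : ℤ} (k : ℤ) {T : Module.End ℂ Δ.Hinf} :
    Δ.conjPow r k T ∈ Δ.intOp r m ↔ T ∈ Δ.intOp r m := by
  refine ⟨fun h => ?_, Δ.conjPow_mem_intOp k⟩
  have h1 := Δ.conjPow_mem_intOp (-k) h
  have h2 : Δ.conjPow r ((-k : ℤ) : ℂ) (Δ.conjPow r k T) = T := by
    have := (Δ.conjPow r k).symm_apply_apply T
    rw [conjPow_apply]
    push_cast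
    rwa [neg_neg]
  rwa [h2] at h1

theorem conjPow_one_mem_intOp_iff {m : ℤ} {T : Module.End ℂ Δ.Hinf} :
    Δ.conjPow r 1 T ∈ Δ.intOp r m ↔ T ∈ Δ.intOp r m := by
  simpa using Δ.conjPow_mem_intOp_iff (r := r) (m := m) 1 (T := T)

variable (r)

/-- The filtered algebra of operators of nonnegative integral analytic order. -/
noncomputable def intOpAlgebra : FilteredOperatorAlgebra ℕ Δ.Hinf where
  alg :=
    { carrier := {X | ∃ m : ℕ, X ∈ Δ.intOp r m}
      add_mem' := by
        rintro X Y ⟨m, hX⟩ ⟨n, hY⟩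
        exact ⟨max m n, (Δ.intOp r _).add_mem (Δ.intOp_mono (by simp) hX)
          (Δ.intOp_mono (by simp) hY)⟩
      zero_mem' := ⟨0, zero_mem _⟩
      mul_mem' := by
        rintro X Y ⟨m, hX⟩ ⟨n, hY⟩
        exact ⟨m + n, by exact_mod_cast Δ.mul_mem_intOp hX hY⟩
      smul_mem' := by
        rintro c X ⟨m, hX⟩
        exact ⟨m, (Δ.intOp r _).smul_mem c hX⟩ }
  filt m := Δ.intOp r m
  filt_mono m n h := Δ.intOp_mono (by exact_mod_cast h)
  mul_mem m n X hX Y hY := by exact_mod_cast Δ.mul_mem_intOp hX hY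
  exhaustive _ := Iff.rfl

end AbstractLaplacian

/-! ### From `Ψ` to `ℬ` and from `ℬ` to `𝒟`. -/

section

variable {H : Type*} [NormedAddCommGroup H] [InnerProductSpace ℂ H] [CompleteSpace H]
variable {Δ : AbstractLaplacian H} {r : ℕ}

open AbstractLaplacian

/-- The elements of a twisted algebra of order-zero operators are bounded between Sobolev spaces of
the same integral degree. -/
theorem TwistedPsiDO₀.alg_le_intOp (ℬ : TwistedPsiDO₀ Δ r) {b : Module.End ℂ Δ.Hinf}
    (hb : b ∈ ℬ.alg) : b ∈ Δ.intOp r 0 := by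
  have hlow := fun s : ℤ => Δ.exists_norm_dpow_le r (z := (s - 1 : ℤ)) (w := s) (by simp)
  suffices h : ∀ s : ℤ, ∀ b ∈ ℬ.alg, ∃ C : ℝ, 0 ≤ C ∧ ∀ v : Δ.Hinf,
      ‖Δ.dpow r s (b v)‖ ≤ C * ‖Δ.dpow r s v‖ from fun s => by simpa using h s b hb
  intro s
  -- The induction covers all `b` at once, since each step replaces `b` by its images under the
  -- twisting and the derivation. Upwards: `Δ^(1/r) b = θ(b) Δ^(1/r) + δ(b)`.
  induction s using Int.induction_on with
  | zero =>
    intro b hb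
    obtain ⟨C, hC⟩ := ℬ.bounded b hb
    refine ⟨|C|, abs_nonneg _, fun v => ?_⟩
    simp only [Int.cast_zero, dpow_zero, Module.End.one_apply]
    exact (hC v).trans (mul_le_mul_of_nonneg_right (le_abs_self C) (norm_nonneg _))
  | succ n ih =>
    intro b hb
    obtain ⟨C₁, hC₁, h₁⟩ := ih _ (ℬ.θ ⟨b, hb⟩).2
    obtain ⟨C₂, hC₂, h₂⟩ := ih _ (ℬ.twisted_derivation ⟨b, hb⟩)
    obtain ⟨C₃, hC₃, h₃⟩ := hlow (n + 1)
    refine ⟨C₁ + C₂ * C₃, by positivity, fun v => ?_⟩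
    have e : Δ.dpow r ((n : ℤ) + 1 : ℤ) (b v) =
        Δ.dpow r (n : ℤ) ((ℬ.θ ⟨b, hb⟩ : Module.End ℂ Δ.Hinf) (Δ.dpow r 1 v)) +
        Δ.dpow r (n : ℤ) ((Δ.dpow r 1 * b -
          (ℬ.θ ⟨b, hb⟩ : Module.End ℂ Δ.Hinf) * Δ.dpow r 1) v) := by
      rw [← map_add, LinearMap.sub_apply, Module.End.mul_apply, Module.End.mul_apply,
        add_sub_cancel, dpow_dpow_apply]
      push_cast
      rfl
    rw [e]
    have h₁' := h₁ (Δ.dpow r 1 v)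
    rw [dpow_dpow_apply] at h₁'
    have h₃' := h₃ v
    rw [add_sub_cancel_right] at h₃'
    push_cast at h₁' h₃' ⊢
    refine (norm_add_le _ _).trans ?_
    rw [add_mul, mul_assoc]
    exact add_le_add h₁' ((h₂ v).trans (mul_le_mul_of_nonneg_left h₃' hC₂))
  | pred n ih =>
    intro b hb
    -- Downwards the twisting must be inverted: with `b = θ(b')`, `Δ^(-1/r) b = b' Δ^(-1/r) -
    -- Δ^(-1/r) δ(b') Δ^(-1/r)`.
    set b' := ℬ.θ.symm ⟨b, hb⟩ with hb'
    obtain ⟨C₁, hC₁, h₁⟩ := ih _ b'.2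
    obtain ⟨C₂, hC₂, h₂⟩ := ih _ (ℬ.twisted_derivation b')
    obtain ⟨C₃, hC₃, h₃⟩ := hlow (-n)
    refine ⟨C₁ + C₃ * C₂, by positivity, fun v => ?_⟩
    have hθ : (ℬ.θ b' : Module.End ℂ Δ.Hinf) = b := by rw [hb', LinearEquiv.apply_symm_apply]
    have e : Δ.dpow r (-(n : ℤ) - 1 : ℤ) (b v) =
        Δ.dpow r (-n : ℤ) ((b' : Module.End ℂ Δ.Hinf) (Δ.dpow r (-1) v)) -
        Δ.dpow r (-n - 1 : ℤ) ((Δ.dpow r 1 * (b' : Module.End ℂ Δ.Hinf) -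
          (ℬ.θ b' : Module.End ℂ Δ.Hinf) * Δ.dpow r 1) (Δ.dpow r (-1) v)) := by
      rw [hθ, LinearMap.sub_apply, Module.End.mul_apply, Module.End.mul_apply, dpow_dpow_apply,
        map_sub, dpow_dpow_apply, add_neg_cancel, dpow_zero]
      push_cast
      rw [sub_add_cancel, sub_sub_cancel]
      rfl
    rw [e]
    have h₁' := h₁ (Δ.dpow r (-1) v)
    have h₂' := h₂ (Δ.dpow r (-1) v)
    rw [dpow_dpow_apply] at h₁' h₂'
    refine (norm_sub_le _ _).trans ?_
    rw [add_mul, mul_assoc]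
    push_cast at h₁' h₂' h₃ ⊢
    exact add_le_add h₁' ((h₃ _).trans (mul_le_mul_of_nonneg_left h₂' hC₃.le))

/-- The difference equals `-δ(b) Δ^(-1/r)`, and `δ(b)`, being in `ℬ`, has order `0`. -/
theorem TwistedPsiDO₀.twisting_sub_conjPow_mem (ℬ : TwistedPsiDO₀ Δ r) (b : ℬ.alg) :
    (ℬ.θ b : Module.End ℂ Δ.Hinf) - Δ.conjPow r 1 b ∈ Δ.intOp r (-1) := by
  have h := Δ.mul_mem_intOp (ℬ.alg_le_intOp (ℬ.twisted_derivation b)) (Δ.dpow_mem_intOp (-1))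
  have e : (ℬ.θ b : Module.End ℂ Δ.Hinf) - Δ.conjPow r 1 b =
      -((Δ.dpow r 1 * (b : Module.End ℂ Δ.Hinf) - (ℬ.θ b : Module.End ℂ Δ.Hinf) * Δ.dpow r 1) *
        Δ.dpow r (-1 : ℤ)) := by
    push_cast
    rw [sub_mul, mul_assoc _ (Δ.dpow r 1), dpow_mul_neg, conjPow_apply, mul_one, neg_sub]
  rw [e]
  rw [zero_add] at h
  exact Submodule.neg_mem _ h

/-- A twisted algebra of differential operators consisting of all operators of nonnegative integral
analytic order, for an automorphism which is conjugation by `Δ^(1/r)` up to operators of negative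
order. -/
noncomputable def TwistedDO.ofIntOp (hr : r ≠ 0)
    (ψ : (Δ.intOpAlgebra r).alg ≃ₗ[ℂ] (Δ.intOpAlgebra r).alg)
    (hψ : ∀ X, (ψ X : Module.End ℂ Δ.Hinf) - Δ.conjPow r 1 X ∈ Δ.intOp r (-1)) :
    TwistedDO Δ r where
  toFilteredOperatorAlgebra := Δ.intOpAlgebra r
  θ := ψ
  θ_mem_filt m X := by
    have h1 : Δ.intOp r (-1) ≤ Δ.intOp r m := Δ.intOp_mono (by omega)
    change _ ∈ Δ.intOp r m ↔ _ ∈ Δ.intOp r m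
    rw [← Δ.conjPow_one_mem_intOp_iff (T := (X : Module.End ℂ Δ.Hinf))]
    exact ⟨fun h => by simpa using Submodule.sub_mem _ h (h1 (hψ X)),
      fun h => by simpa using Submodule.add_mem _ (h1 (hψ X)) h⟩
  twisted_commutator m X hX := by
    -- Agreement with conjugation modulo order `-1` survives iteration because conjugation preserves
    -- that order. At `n = r` the conjugation is by `Δ` itself.
    have key : ∀ n : ℕ, ((ψ ^ n) X : Module.End ℂ Δ.Hinf) - Δ.conjPow r n X ∈ Δ.intOp r (-1) := by
      intro n
      induction n with
      | zero =>
        rw [conjPow_apply]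
        simp [dpow_zero]
      | succ n ih =>
        have e : Δ.conjPow r (n + 1 : ℕ) X = Δ.conjPow r 1 (Δ.conjPow r n X) := by
          simp only [conjPow_apply]
          rw [show ((n + 1 : ℕ) : ℂ) = 1 + n by push_cast; ring,
            show -(1 + (n : ℂ)) = -n + -1 by ring, dpow_add, dpow_add]
          noncomm_ring
        have h1 := hψ ((ψ ^ n) X)
        have h2 := Δ.conjPow_mem_intOp 1 ih
        rw [Int.cast_one, map_sub, ← e] at h2
        rw [pow_succ']
        simpa using! Submodule.add_mem _ h1 h2
    have h1 := Δ.mul_mem_intOp (key r) (Δ.dpow_mem_intOp r)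
    have e : Δ.conjPow r r X * Δ.dpow r ((r : ℤ) : ℂ) = Δ.lap * X := by
      rw [conjPow_apply, Int.cast_natCast, mul_assoc, dpow_neg_mul, mul_one, Δ.dpow_self hr]
    rw [sub_mul, e, Int.cast_natCast, Δ.dpow_self hr] at h1
    have h2 := Submodule.neg_mem _ h1
    rw [neg_sub] at h2
    -- The twisted commutator has order `r - 1` whatever `m` is.
    exact Δ.intOp_mono (by omega) h2
  elliptic_estimate m X hX := by
    obtain ⟨C, hC, h⟩ := hX m
    refine ⟨C + 1, by positivity, fun v => ?_⟩
    have h1 := h v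
    rw [sub_self, Int.cast_zero, dpow_zero] at h1
    refine h1.trans ?_
    rw [add_mul]
    have : 0 ≤ 1 * ‖Δ.cpow ((m : ℂ) / r) v‖ := by positivity
    exact le_add_of_le_of_nonneg le_rfl this

variable {𝒜 : NonUnitalSubalgebra ℂ (Module.End ℂ Δ.Hinf)} {θ : 𝒜 ≃ₗ[ℂ] 𝒜}

theorem AbstractLaplacian.conjPow_one_mem_intOpAlgebra_iff {X : Module.End ℂ Δ.Hinf} :
    Δ.conjPow r 1 X ∈ (Δ.intOpAlgebra r).alg ↔ X ∈ (Δ.intOpAlgebra r).alg :=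
  exists_congr fun _ => Δ.conjPow_one_mem_intOp_iff

/-- Conjugation by `Δ^(1/r)` on the operators of nonnegative integral analytic order. -/
noncomputable def AbstractLaplacian.intOpConj (Δ : AbstractLaplacian H) (r : ℕ) :
    (Δ.intOpAlgebra r).alg ≃ₗ[ℂ] (Δ.intOpAlgebra r).alg where
  toFun X := ⟨Δ.conjPow r 1 X, conjPow_one_mem_intOpAlgebra_iff.2 X.2⟩
  invFun X := ⟨(Δ.conjPow r 1).symm X,
    conjPow_one_mem_intOpAlgebra_iff.1 (by rw [AlgEquiv.apply_symm_apply]; exact X.2)⟩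
  map_add' X Y := Subtype.ext (map_add (Δ.conjPow r 1) X.1 Y.1)
  map_smul' c X := Subtype.ext (map_smul (Δ.conjPow r 1) c X.1)
  left_inv X := Subtype.ext ((Δ.conjPow r 1).symm_apply_apply X.1)
  right_inv X := Subtype.ext ((Δ.conjPow r 1).apply_symm_apply X.1)

/-- Here `W` lies in the ambient algebra and need not be contained in `V`; the extension is carried
out modulo `W ∩ V`. -/
theorem NonUnitalSubalgebra.exists_extend_modulo {E : Type*} [Ring E] [Algebra ℂ E]
    {A V : NonUnitalSubalgebra ℂ E} (hle : A ≤ V) (W : Submodule ℂ E) (φ : V ≃ₗ[ℂ] V)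
    (hφ : ∀ X, (φ X : E) ∈ W ↔ (X : E) ∈ W) (θ : A ≃ₗ[ℂ] A)
    (hθ : ∀ a : A, (θ a : E) - φ ⟨a, hle a.2⟩ ∈ W) :
    ∃ ψ : V ≃ₗ[ℂ] V, (∀ X, (ψ X : E) - φ X ∈ W) ∧ ∀ a : A, (ψ ⟨a, hle a.2⟩ : E) = θ a := by
  obtain ⟨i, hi⟩ : ∃ i : A →ₗ[ℂ] V, ∀ a : A, i a = ⟨a, hle a.2⟩ :=
    ⟨{ toFun := fun a => ⟨a, hle a.2⟩
       map_add' := fun _ _ => rfl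
       map_smul' := fun _ _ => rfl }, fun _ => rfl⟩
  obtain ⟨W', hW⟩ : ∃ W' : Submodule ℂ V, ∀ X, X ∈ W' ↔ (X : E) ∈ W :=
    ⟨{ carrier := {X | (X : E) ∈ W}
       add_mem' := fun h h' => W.add_mem h h'
       zero_mem' := W.zero_mem
       smul_mem' := fun c _ h => W.smul_mem c h }, fun _ => Iff.rfl⟩
  have hinj : Function.Injective i := fun a b h => by
    rw [hi, hi] at h
    exact Subtype.ext (congrArg (fun x : V => (x : E)) h)
  obtain ⟨ψ, hψ, hψi⟩ := LinearEquiv.exists_extend_modulo (K := ℂ) (A := A) (V := V) W' φ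
    (fun X => by rw [hW, hW]; exact hφ X) hinj θ (fun a => by rw [hW, hi, hi]; exact hθ a)
  refine ⟨ψ, fun X => (hW _).1 (hψ X), fun a => ?_⟩
  rw [← hi, hψi, hi]

theorem TwistedPsiDO₀.exists_twistedDO (hr : r ≠ 0) (ℬ : TwistedPsiDO₀ Δ r)
    (hℬ : ℬ.Compatible 𝒜 θ) : ∃ 𝒟 : TwistedDO Δ r, 𝒟.Compatible 𝒜 θ := by
  have hmem : ∀ a ∈ 𝒜, a ∈ Δ.intOp r 0 := fun a ha => ℬ.alg_le_intOp (hℬ ⟨a, ha⟩).1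
  obtain ⟨ψ, hψ, hψi⟩ := NonUnitalSubalgebra.exists_extend_modulo
    (fun a ha => ⟨0, hmem a ha⟩ : 𝒜 ≤ (Δ.intOpAlgebra r).alg) (Δ.intOp r (-1)) (Δ.intOpConj r)
    (fun _ => Δ.conjPow_one_mem_intOp_iff) θ (fun a => by
      obtain ⟨h, hθ⟩ := hℬ a
      have h1 := ℬ.twisting_sub_conjPow_mem ⟨a, h⟩
      rw [hθ] at h1
      exact h1)
  exact ⟨TwistedDO.ofIntOp hr ψ hψ, fun a => ⟨hmem a a.2, ⟨0, hmem a a.2⟩, hψi a⟩⟩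

theorem TwistedPsiDO.filt_le_alg (Ψ : TwistedPsiDO Δ r) {t : ℝ} {P : Module.End ℂ Δ.Hinf}
    (hP : P ∈ Ψ.filt t) : P ∈ Ψ.alg := (Ψ.exhaustive _).2 ⟨t, hP⟩

/-- The restriction of `Θ^1` to `Ψ^0`. -/
noncomputable def TwistedPsiDO.twistZero (Ψ : TwistedPsiDO Δ r) : Ψ.filt 0 ≃ₗ[ℂ] Ψ.filt 0 where
  toFun P := ⟨Ψ.Θ 1 ⟨P, Ψ.filt_le_alg P.2⟩, (Ψ.Θ_mem_filt 1 0 _).2 P.2⟩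
  invFun P := ⟨(Ψ.Θ 1).symm ⟨P, Ψ.filt_le_alg P.2⟩,
    (Ψ.Θ_mem_filt 1 0 _).1 (by rw [LinearEquiv.apply_symm_apply]; exact P.2)⟩
  map_add' P Q := Subtype.ext
    (congrArg (fun x : Ψ.alg => (x : Module.End ℂ Δ.Hinf))
      ((Ψ.Θ 1).map_add ⟨P, Ψ.filt_le_alg P.2⟩ ⟨Q, Ψ.filt_le_alg Q.2⟩))
  map_smul' c P := Subtype.ext
    (congrArg (fun x : Ψ.alg => (x : Module.End ℂ Δ.Hinf))
      ((Ψ.Θ 1).map_smul c ⟨P, Ψ.filt_le_alg P.2⟩))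
  left_inv P := Subtype.ext (by simp)
  right_inv P := Subtype.ext (by simp)

/-- Take `ℬ = Ψ^0` with `Θ^1` corrected to `ψ`, which extends `θ`. Since `ψ - Θ^1` has values in
`Ψ^(-1)`, the correction changes `δ(b)` by an element of `Ψ^(-1) Δ^(1/r) ⊆ Ψ^0`. -/
theorem TwistedPsiDO.exists_twistedPsiDO₀ (Ψ : TwistedPsiDO Δ r) (hΨ : Ψ.Compatible 𝒜 θ) :
    ∃ ℬ : TwistedPsiDO₀ Δ r, ℬ.Compatible 𝒜 θ := by
  have hle : ∀ {P}, P ∈ Ψ.filt 0 → P ∈ Ψ.alg := Ψ.filt_le_alg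
  obtain ⟨i, hi⟩ : ∃ i : 𝒜 →ₗ[ℂ] Ψ.filt 0, ∀ a, (i a : Module.End ℂ Δ.Hinf) = a :=
    ⟨{ toFun := fun a => ⟨a, (hΨ a).1⟩
       map_add' := fun _ _ => rfl
       map_smul' := fun _ _ => rfl }, fun _ => rfl⟩
  obtain ⟨W, hW⟩ : ∃ W : Submodule ℂ (Ψ.filt 0),
      ∀ X, X ∈ W ↔ (X : Module.End ℂ Δ.Hinf) ∈ Ψ.filt (-1) :=
    ⟨(Ψ.filt (-1)).comap (Ψ.filt 0).subtype, fun _ => Iff.rfl⟩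
  have hφ : ∀ P, Ψ.twistZero P ∈ W ↔ P ∈ W := fun P => by
    rw [hW, hW]
    exact Ψ.Θ_mem_filt 1 (-1) ⟨P, hle P.2⟩
  have hinj : Function.Injective i := fun a b h => Subtype.ext (by rw [← hi, h, hi])
  have hθ : ∀ a, i (θ a) - Ψ.twistZero (i a) ∈ W := fun a => by
    obtain ⟨-, h, hθ⟩ := hΨ a
    have h1 := Submodule.neg_mem _ hθ
    rw [neg_sub, ← hi] at h1
    rw [hW, Submodule.coe_sub]
    have e : (⟨i a, hle (i a).2⟩ : Ψ.alg) = ⟨a, h⟩ := Subtype.ext (hi a)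
    change _ - (Ψ.Θ 1 ⟨i a, hle (i a).2⟩ : Module.End ℂ Δ.Hinf) ∈ _
    rw [e]
    exact h1
  obtain ⟨ψ, hψ, hψi⟩ := LinearEquiv.exists_extend_modulo (K := ℂ) (A := 𝒜) (V := Ψ.filt 0)
    W Ψ.twistZero hφ hinj θ hθ
  have hψ' : ∀ b, (ψ b : Module.End ℂ Δ.Hinf) - (Ψ.Θ 1 ⟨b, hle b.2⟩ : Module.End ℂ Δ.Hinf) ∈
      Ψ.filt (-1) := fun b => (hW _).1 (hψ b)
  have hψi' : ∀ a : 𝒜, (ψ ⟨a, (hΨ a).1⟩ : Module.End ℂ Δ.Hinf) = θ a := fun a => by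
    have e : i a = ⟨a, (hΨ a).1⟩ := Subtype.ext (hi a)
    rw [← e, hψi, hi]
  have hmul : ∀ {P Q}, P ∈ Ψ.filt 0 → Q ∈ Ψ.filt 0 → P * Q ∈ Ψ.filt 0 := fun {P Q} hP hQ => by
    simpa using Ψ.mul_mem 0 0 P hP Q hQ
  refine ⟨⟨{ Ψ.filt 0 with mul_mem' := hmul }, fun b hb => ?_, ψ, fun b => ?_⟩,
    fun a => ⟨(hΨ a).1, hψi' a⟩⟩
  · obtain ⟨C, hC⟩ := Ψ.isOp_zero b hb 0
    refine ⟨C, fun v => ?_⟩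
    have := hC v
    simp only [sobolevNorm, sub_zero, Complex.ofReal_zero, zero_div, cpow_zero] at this
    exact this
  · have hb : (b : Module.End ℂ Δ.Hinf) ∈ Ψ.filt 0 := b.2
    have h1 := Ψ.twisted_commutator 1 0 ⟨b, hle hb⟩ hb
    have h2 := Ψ.mul_cpow_mem 1 (-1) _ (hψ' b)
    rw [Complex.one_re, add_neg_cancel] at h2
    rw [Complex.one_re, add_zero, sub_self] at h1
    have h3 := Submodule.sub_mem _ h1 h2
    have e : Δ.cpow (1 / r) * (b : Module.End ℂ Δ.Hinf) -
        (ψ b : Module.End ℂ Δ.Hinf) * Δ.cpow (1 / r) =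
        (Δ.cpow (1 / r) * (b : Module.End ℂ Δ.Hinf) -
          (Ψ.Θ 1 ⟨b, hle hb⟩ : Module.End ℂ Δ.Hinf) * Δ.cpow (1 / r)) -
        ((ψ b : Module.End ℂ Δ.Hinf) - (Ψ.Θ 1 ⟨b, hle hb⟩ : Module.End ℂ Δ.Hinf)) *
          Δ.cpow (1 / r) := by
      rw [sub_mul]; abel
    exact e ▸ h3

end

/-! ### Scalar integrals of resolvent kernels -/

section ScalarIntegrals

open MeasureTheory Set

/-- Dominated by `t^(-σ)` near `0` and by `t^(-σ-1)` near infinity. All majorants in the expansion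
are multiples of this function, whence the restriction `0 < Re z < 1`. -/
theorem integrableOn_rpow_div_one_add {σ : ℝ} (h0 : 0 < σ) (h1 : σ < 1) :
    IntegrableOn (fun t : ℝ => t ^ (-σ) / (1 + t)) (Ioi 0) := by
  have hm : ∀ s : Set ℝ, s ⊆ Ioi 0 → MeasurableSet s →
      AEStronglyMeasurable (fun t : ℝ => t ^ (-σ) / (1 + t)) (volume.restrict s) := by
    intro s hs hms
    refine ContinuousOn.aestronglyMeasurable (fun t ht => ?_) hms
    have ht0 : 0 < t := hs ht
    exact ((Real.continuousAt_rpow_const _ _ (Or.inl ht0.ne')).div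
      (by fun_prop) (by positivity)).continuousWithinAt
  rw [← Ioc_union_Ioi_eq_Ioi (zero_le_one' ℝ)]
  refine IntegrableOn.union ?_ ?_
  · have h : IntegrableOn (fun t : ℝ => t ^ (-σ)) (Ioc 0 1) := by
      rw [← intervalIntegrable_iff_integrableOn_Ioc_of_le zero_le_one]
      exact intervalIntegral.intervalIntegrable_rpow' (by linarith)
    refine Integrable.mono' h (hm _ (fun t ht => ht.1) measurableSet_Ioc) ?_
    refine (ae_restrict_mem measurableSet_Ioc).mono fun t ht => ?_
    have ht0 : 0 < t := ht.1
    rw [Real.norm_of_nonneg (by positivity)]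
    exact div_le_self (by positivity) (by linarith)
  · have h : IntegrableOn (fun t : ℝ => t ^ (-σ - 1)) (Ioi 1) :=
      integrableOn_Ioi_rpow_of_lt (by linarith) one_pos
    refine Integrable.mono' h (hm _ (Ioi_subset_Ioi zero_le_one) measurableSet_Ioi) ?_
    refine (ae_restrict_mem measurableSet_Ioi).mono fun t ht => ?_
    have ht0 : 0 < t := one_pos.trans ht
    rw [Real.norm_of_nonneg (by positivity), Real.rpow_sub_one ht0.ne']
    gcongr
    linarith

/-- The substitution `t = x / (1 - x)` gives the Beta integral `B(1 - z, z)`, a quotient of values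
of `Γ`, which has no zeros here. Solving for `Δ^(-z) X` divides by this constant. -/
theorem integral_cpow_div_one_add_ne_zero {z : ℂ} (h0 : 0 < z.re) (h1 : z.re < 1) :
    ∫ t in Ioi (0 : ℝ), (t : ℂ) ^ (-z) / (t + 1) ≠ 0 := by
  have himg : (fun x : ℝ => x / (1 - x)) '' Ioo 0 1 = Ioi 0 := by
    ext t
    constructor
    · rintro ⟨x, hx, rfl⟩
      exact div_pos hx.1 (by linarith [hx.2])
    · intro ht
      have ht' : 0 < t := ht
      refine ⟨t / (1 + t), ⟨by positivity, by rw [div_lt_one (by positivity)]; linarith⟩, ?_⟩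
      field_simp
      ring
  have hinj : InjOn (fun x : ℝ => x / (1 - x)) (Ioo 0 1) := by
    intro x hx y hy h
    have hx1 : 1 - x ≠ 0 := by linarith [hx.2]
    have hy1 : 1 - y ≠ 0 := by linarith [hy.2]
    have h' : x / (1 - x) = y / (1 - y) := h
    rw [div_eq_div_iff hx1 hy1] at h'
    linarith
  have hder : ∀ x ∈ Ioo (0 : ℝ) 1,
      HasDerivWithinAt (fun x : ℝ => x / (1 - x)) (1 / (1 - x) ^ 2) (Ioo 0 1) x := by
    intro x hx
    have hx1 : 1 - x ≠ 0 := by linarith [hx.2]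
    have := (hasDerivAt_id x).div ((hasDerivAt_id x).const_sub 1) hx1
    refine (this.congr_deriv ?_).hasDerivWithinAt
    simp
  rw [← himg, integral_image_eq_integral_abs_deriv_smul measurableSet_Ioo hder hinj]
  have hbeta : ∫ x in Ioo (0 : ℝ) 1, |1 / (1 - x) ^ 2| •
      (((x / (1 - x) : ℝ) : ℂ) ^ (-z) / ((x / (1 - x) : ℝ) + 1)) =
      Complex.betaIntegral (1 - z) z := by
    rw [Complex.betaIntegral, intervalIntegral.integral_of_le zero_le_one, integral_Ioc_eq_integral_Ioo]
    refine setIntegral_congr_fun measurableSet_Ioo fun x hx => ?_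
    have hx0 : 0 < x := hx.1
    have hx1 : 0 < 1 - x := by linarith [hx.2]
    have e1 : ((x / (1 - x) : ℝ) : ℂ) ^ (-z) = (x : ℂ) ^ (-z) * ((1 - x : ℝ) : ℂ) ^ z := by
      rw [div_eq_mul_inv, Complex.ofReal_mul,
        Complex.mul_cpow_ofReal_nonneg hx0.le (by positivity), Complex.ofReal_inv,
        Complex.inv_cpow_eq_ite, if_neg, Complex.cpow_neg (((1 - x : ℝ) : ℂ)), inv_inv]
      rw [Complex.arg_ofReal_of_nonneg hx1.le]
      exact Real.pi_pos.ne
    have hx1' : ((1 - x : ℝ) : ℂ) ≠ 0 := by exact_mod_cast hx1.ne'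
    have e2 : ((x / (1 - x) : ℝ) : ℂ) + 1 = ((1 - x : ℝ) : ℂ)⁻¹ := by
      rw [Complex.ofReal_div]
      field_simp
      push_cast
      ring
    rw [abs_of_nonneg (by positivity), e1, e2, show (1 : ℂ) - z - 1 = -z by ring,
      show (1 : ℂ) - (x : ℂ) = ((1 - x : ℝ) : ℂ) by push_cast; rfl, Complex.cpow_sub _ _ hx1',
      Complex.cpow_one, Complex.real_smul]
    push_cast at hx1' ⊢
    field_simp
  rw [hbeta]
  intro h
  have := Complex.Gamma_mul_Gamma_eq_betaIntegral (s := 1 - z) (t := z) (by simpa using h1) h0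
  rw [h, mul_zero] at this
  exact mul_ne_zero (Complex.Gamma_ne_zero_of_re_pos (by simpa using h1))
    (Complex.Gamma_ne_zero_of_re_pos h0) this

/-- The kernel `∏ x / (t x + μ)`, the value at `x = 1 / λ` of `∏ (t + μ λ)⁻¹`. -/
noncomputable def resolventKernel (M : List ℝ) (t : ℝ) (x : ℂ) : ℂ :=
  (M.map fun μ : ℝ => x / (t * x + μ)).prod

theorem resolventKernel_cons (μ : ℝ) (M : List ℝ) (t : ℝ) (x : ℂ) :
    resolventKernel (μ :: M) t x = x / (t * x + μ) * resolventKernel M t x := by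
  simp [resolventKernel]

theorem integral_resolventKernel (z : ℂ) (μ : ℝ) (M : List ℝ) {x : ℝ} (hx : 0 < x) :
    ∫ t in Ioi (0 : ℝ), (t : ℂ) ^ (-z) * resolventKernel (μ :: M) t x =
      (∫ t in Ioi (0 : ℝ), (t : ℂ) ^ (-z) * resolventKernel (μ :: M) t 1) *
        (x : ℂ) ^ (z + M.length) := by
  have hx' : (x : ℂ) ≠ 0 := by exact_mod_cast hx.ne'
  -- Homogeneity of the kernel. After `t ↦ t / x`, the factors `x^(M.length + 1)`, `x^z` and `x⁻¹`
  -- combine to `x^(z + M.length)`.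
  have key : ∀ (M : List ℝ) (t : ℝ),
      resolventKernel M t x = (x : ℂ) ^ M.length * resolventKernel M (x * t) 1 := by
    intro M t
    induction M with
    | nil => simp [resolventKernel]
    | cons μ M ih =>
      rw [resolventKernel_cons, resolventKernel_cons, ih, List.length_cons]
      push_cast
      ring
  have h1 := integral_comp_mul_left_Ioi
    (fun t : ℝ => (t : ℂ) ^ (-z) * resolventKernel (μ :: M) t 1) 0 hx
  rw [mul_zero] at h1
  have h2 : ∀ t ∈ Ioi (0 : ℝ), (t : ℂ) ^ (-z) * resolventKernel (μ :: M) t x =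
      (x : ℂ) ^ (z + M.length + 1) *
        (((x * t : ℝ) : ℂ) ^ (-z) * resolventKernel (μ :: M) (x * t) 1) := by
    intro t ht
    rw [key, Complex.ofReal_mul, Complex.mul_cpow_ofReal_nonneg hx.le (le_of_lt ht),
      List.length_cons, Complex.cpow_neg _ z, add_assoc, Complex.cpow_add _ _ hx',
      show (M.length : ℂ) + 1 = ((M.length + 1 : ℕ) : ℂ) by push_cast; rfl, Complex.cpow_natCast, Complex.cpow_neg (x : ℂ)]
    have : (x : ℂ) ^ z ≠ 0 := by simp [Complex.cpow_eq_zero_iff, hx']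
    field_simp
  rw [setIntegral_congr_fun measurableSet_Ioi h2, integral_const_mul, h1, Complex.cpow_add _ _ hx',
    Complex.cpow_one, Complex.real_smul]
  push_cast
  field_simp

/-- The explicit dependence on `μ` matters: `μ^(-z)` is the coefficient of the leading term of
`Δ^(-z) X`. It comes from rescaling `x` to `x / μ`. -/
theorem integral_resolventKernel_singleton (z : ℂ) {μ : ℝ} (hμ : 0 < μ) {x : ℝ} (hx : 0 < x) :
    ∫ t in Ioi (0 : ℝ), (t : ℂ) ^ (-z) * resolventKernel [μ] t x =
      (∫ t in Ioi (0 : ℝ), (t : ℂ) ^ (-z) / (t + 1)) * (μ : ℂ) ^ (-z) * (x : ℂ) ^ z := by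
  have h1 := integral_resolventKernel z 1 [] (div_pos hx hμ)
  have hμ' : (μ : ℂ) ≠ 0 := by exact_mod_cast hμ.ne'
  have e : ∀ t : ℝ, resolventKernel [1] t ((x / μ : ℝ) : ℂ) = resolventKernel [μ] t x := by
    intro t
    simp only [resolventKernel, List.map_cons, List.map_nil, List.prod_cons, List.prod_nil, mul_one]
    have : (t : ℂ) * ((x / μ : ℝ) : ℂ) + (1 : ℝ) = (t * x + μ) / μ := by
      push_cast
      field_simp
    rw [this]
    push_cast
    rw [div_div_div_cancel_right₀ hμ']
  have e' : ∀ t : ℝ, (t : ℂ) ^ (-z) * resolventKernel [1] t 1 = (t : ℂ) ^ (-z) / (t + 1) := by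
    intro t
    simp [resolventKernel, div_eq_mul_inv]
  simp only [e, e'] at h1
  rw [h1, mul_assoc, List.length_nil, Nat.cast_zero, add_zero, div_eq_mul_inv, Complex.ofReal_mul,
    Complex.mul_cpow_ofReal_nonneg hx.le (by positivity), Complex.ofReal_inv,
    Complex.inv_cpow_eq_ite, if_neg, Complex.cpow_neg]
  · ring
  · rw [Complex.arg_ofReal_of_nonneg hμ.le]
    exact Real.pi_pos.ne

theorem norm_div_add_le {t μ x N : ℝ} (ht : 0 < t) (hμ : 0 < μ) (hx : 0 ≤ x) (hxN : x ≤ N) :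
    ‖(x : ℂ) / (t * x + μ)‖ ≤ (1 + N / μ) * (1 + t)⁻¹ := by
  have e : (x : ℂ) / (t * x + μ) = ((x / (t * x + μ) : ℝ) : ℂ) := by push_cast; rfl
  have hp : 0 < t * x + μ := by positivity
  rw [e, Complex.norm_real, Real.norm_of_nonneg (by positivity), ← div_eq_mul_inv,
    div_le_div_iff₀ hp (by positivity)]
  have h1 : N / μ * (t * x + μ) = N + N / μ * (t * x) := by field_simp; ring
  have h2 : 0 ≤ N / μ * (t * x) := by
    have : 0 ≤ N := hx.trans hxN
    positivity
  nlinarith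

theorem norm_inv_add_le {t μ x : ℝ} (ht : 0 < t) (hμ : 0 < μ) (hx : 0 ≤ x) :
    ‖((t : ℂ) * x + μ)⁻¹‖ ≤ μ⁻¹ := by
  have e : ((t : ℂ) * x + μ)⁻¹ = (((t * x + μ)⁻¹ : ℝ) : ℂ) := by push_cast; rfl
  have hp : 0 < t * x + μ := by positivity
  rw [e, Complex.norm_real, Real.norm_of_nonneg (by positivity)]
  exact inv_anti₀ hμ (by nlinarith [mul_nonneg ht.le hx])

theorem ofReal_mul_add_ne_zero {t μ x : ℝ} (ht : 0 < t) (hμ : 0 < μ) (hx : 0 ≤ x) :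
    (t : ℂ) * x + μ ≠ 0 := by
  have hp : 0 < t * x + μ := by positivity
  exact_mod_cast hp.ne'

theorem exists_norm_resolventKernel_le {N : ℝ} (hN : 0 ≤ N) (M : List ℝ) (hM : ∀ μ ∈ M, 0 < μ) :
    ∃ C : ℝ, 0 ≤ C ∧ ∀ t x : ℝ, 0 < t → 0 ≤ x → x ≤ N → ‖resolventKernel M t x‖ ≤ C := by
  induction M with
  | nil => exact ⟨1, zero_le_one, fun t x _ _ _ => by simp [resolventKernel]⟩
  | cons μ M ih =>
    obtain ⟨C, hC, h⟩ := ih fun μ hμ => hM μ (List.mem_cons_of_mem _ hμ)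
    have hμ : 0 < μ := hM μ List.mem_cons_self
    refine ⟨(1 + N / μ) * C, by positivity, fun t x ht hx hxN => ?_⟩
    rw [resolventKernel_cons, norm_mul]
    refine mul_le_mul ((norm_div_add_le ht hμ hx hxN).trans ?_) (h t x ht hx hxN) (norm_nonneg _)
      (by positivity)
    exact mul_le_of_le_one_right (by positivity) (inv_le_one_of_one_le₀ (by linarith))

end ScalarIntegrals

namespace AbstractLaplacian

open MeasureTheory Set

variable {H : Type*} [NormedAddCommGroup H] [InnerProductSpace ℂ H] [CompleteSpace H]
variable (Δ : AbstractLaplacian H)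

/-! ### Resolvents -/

/-- The resolvent `(t + μ Δ)⁻¹` on `H^∞`. -/
noncomputable def res (μ t : ℝ) : Module.End ℂ Δ.Hinf := Δ.fc fun x => x / (t * x + μ)

/-- The product of the resolvents `(t + μ Δ)⁻¹`, `μ ∈ M`. -/
noncomputable def resProd (M : List ℝ) (t : ℝ) : Module.End ℂ Δ.Hinf :=
  (M.map fun μ => Δ.res μ t).prod

theorem resProd_nil (t : ℝ) : Δ.resProd [] t = 1 := rfl

theorem resProd_cons (μ : ℝ) (M : List ℝ) (t : ℝ) :
    Δ.resProd (μ :: M) t = Δ.res μ t * Δ.resProd M t := by simp [resProd]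

theorem commute_res_cpow (μ t : ℝ) (z : ℂ) : Commute (Δ.res μ t) (Δ.cpow z) :=
  Δ.commute_fc_cpow _ _

theorem commute_resProd_cpow (M : List ℝ) (t : ℝ) (z : ℂ) :
    Commute (Δ.resProd M t) (Δ.cpow z) := by
  induction M with
  | nil => exact Commute.one_left _
  | cons μ M ih => rw [resProd_cons]; exact (Δ.commute_res_cpow μ t z).mul_left ih

theorem continuousOn_inv_add {t μ : ℝ} (ht : 0 < t) (hμ : 0 < μ) :
    ContinuousOn (fun x : ℂ => ((t : ℂ) * x + μ)⁻¹) (spectrum ℂ Δ.inv) := by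
  refine ContinuousOn.inv₀ (by fun_prop) fun x hx => ?_
  obtain ⟨y, hy, -, rfl⟩ := Δ.exists_of_mem_spectrum hx
  exact ofReal_mul_add_ne_zero ht hμ hy

theorem continuousOn_resolventKernel {M : List ℝ} (hM : ∀ μ ∈ M, 0 < μ) :
    ContinuousOn (fun p : ℝ × ℂ => resolventKernel M p.1 p.2) (Ioi 0 ×ˢ spectrum ℂ Δ.inv) := by
  induction M with
  | nil => simpa [resolventKernel] using! continuousOn_const
  | cons μ M ih =>
    simp only [resolventKernel_cons]
    refine ContinuousOn.mul (ContinuousOn.div (by fun_prop) (by fun_prop) ?_)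
      (ih fun μ hμ => hM μ (List.mem_cons_of_mem _ hμ))
    rintro ⟨t, x⟩ ⟨ht, hx⟩
    obtain ⟨y, hy, -, rfl⟩ := Δ.exists_of_mem_spectrum hx
    exact ofReal_mul_add_ne_zero ht (hM μ List.mem_cons_self) hy

theorem continuousOn_resolventKernel_right {M : List ℝ} (hM : ∀ μ ∈ M, 0 < μ) {t : ℝ} (ht : 0 < t) :
    ContinuousOn (fun x => resolventKernel M t x) (spectrum ℂ Δ.inv) :=
  (Δ.continuousOn_resolventKernel hM).comp (f := fun x : ℂ => (t, x)) (by fun_prop)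
    fun _ hx => ⟨ht, hx⟩

/-- Splitting off `Δ⁻¹` leaves a factor bounded by `μ⁻¹` uniformly in `t`. -/
theorem res_eq {t μ : ℝ} (ht : 0 < t) (hμ : 0 < μ) :
    Δ.res μ t = Δ.fc (fun x => ((t : ℂ) * x + μ)⁻¹) * Δ.npow 1 := by
  rw [npow_one, ← Δ.fc_mul (Δ.continuousOn_inv_add ht hμ) (continuousOn_id' _)]
  exact Δ.fc_congr fun x _ => by rw [div_eq_mul_inv, mul_comm]

theorem fc_one : Δ.fc (fun _ => 1) = 1 := by
  ext v
  rw [coe_fc, cfc_const_one ℂ Δ.inv]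
  rfl

theorem resProd_eq {M : List ℝ} (hM : ∀ μ ∈ M, 0 < μ) {t : ℝ} (ht : 0 < t) :
    Δ.resProd M t = Δ.fc (resolventKernel M t) := by
  induction M with
  | nil => exact Δ.fc_one.symm
  | cons μ M ih =>
    have hM' : ∀ μ ∈ M, 0 < μ := fun μ hμ => hM μ (List.mem_cons_of_mem _ hμ)
    have hc := Δ.continuousOn_resolventKernel_right (M := [μ])
      (fun ν hν => hM ν (by simp_all)) ht
    rw [resProd_cons, ih hM', res]
    have e : resolventKernel (μ :: M) t =
        fun x => resolventKernel [μ] t x * resolventKernel M t x := by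
      ext x
      simp [resolventKernel]
    rw [e, Δ.fc_mul hc (Δ.continuousOn_resolventKernel_right hM' ht)]
    congr 1
    exact Δ.fc_congr fun x _ => by simp [resolventKernel]

theorem smul_add_mul_res {t μ : ℝ} (ht : 0 < t) (hμ : 0 < μ) :
    (t : ℂ) • Δ.res μ t + (μ : ℂ) • (Δ.lap * Δ.res μ t) = 1 := by
  have h1 : Δ.res μ t * Δ.fc (fun x => (t : ℂ) * x + μ) = Δ.fc (fun x => x) := by
    rw [Δ.res_eq ht hμ, npow_one, (Δ.commute_fc _ _).eq, mul_assoc,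
      ← Δ.fc_mul (Δ.continuousOn_inv_add ht hμ) (by fun_prop),
      ← Δ.fc_mul (continuousOn_id' _)]
    · refine Δ.fc_congr fun x hx => ?_
      obtain ⟨y, hy, -, rfl⟩ := Δ.exists_of_mem_spectrum hx
      rw [inv_mul_cancel₀ (ofReal_mul_add_ne_zero ht hμ hy), mul_one]
    · refine ContinuousOn.mul (Δ.continuousOn_inv_add ht hμ) (by fun_prop)
  have h2 : Δ.fc (fun x => (t : ℂ) * x + μ) = (t : ℂ) • Δ.fc (fun x => x) + (μ : ℂ) • 1 := by
    ext v
    rw [coe_fc, cfc_add (a := Δ.inv) (fun x : ℂ => (t : ℂ) * x) (fun _ => (μ : ℂ)),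
      cfc_const_mul (t : ℂ) (fun x : ℂ => x) Δ.inv, cfc_const (μ : ℂ) Δ.inv]
    simp [coe_fc, Algebra.algebraMap_eq_smul_one]
  have h3 := congrArg (fun T => T * Δ.lap) h1
  simp only [fc_id] at h3
  rw [h2, mul_add, add_mul, mul_smul_comm, mul_smul_comm, mul_one, smul_mul_assoc, smul_mul_assoc,
    mul_assoc, fc_id, mul_one] at h3
  rwa [res, ← (Δ.commute_fc_lap _).eq]

theorem res_mul_smul_add {t μ : ℝ} (ht : 0 < t) (hμ : 0 < μ) :
    (t : ℂ) • Δ.res μ t + (μ : ℂ) • (Δ.res μ t * Δ.lap) = 1 := by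
  rw [← Δ.smul_add_mul_res ht hμ, res, (Δ.commute_fc_lap _).eq]

/-- The twisted resolvent identity. -/
theorem res_one_mul {X Y : Module.End ℂ Δ.Hinf} {μ : ℝ} (hμ : 0 < μ)
    (hXY : Δ.lap * X - (μ : ℂ) • (X * Δ.lap) = Y) {t : ℝ} (ht : 0 < t) :
    Δ.res 1 t * X = X * Δ.res μ t - Δ.res 1 t * Y * Δ.res μ t := by
  have h1 := Δ.res_mul_smul_add ht one_pos
  have h2 := Δ.smul_add_mul_res ht hμ
  rw [Complex.ofReal_one, one_smul] at h1
  have h3 : X * Δ.res μ t = ((t : ℂ) • Δ.res 1 t + Δ.res 1 t * Δ.lap) * (X * Δ.res μ t) := by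
    rw [h1, one_mul]
  have h4 : Δ.res 1 t * X = Δ.res 1 t * X *
      ((t : ℂ) • Δ.res μ t + (μ : ℂ) • (Δ.lap * Δ.res μ t)) := by rw [h2, mul_one]
  rw [eq_sub_iff_add_eq, h3, h4, ← hXY]
  simp only [mul_add, add_mul, mul_sub, sub_mul, smul_mul_assoc, mul_smul_comm, mul_assoc]
  abel

/-- Each resolvent can be spent in one of two ways: here on decay in `t`, in `norm_resProd_le` on a
gain of one power of `Δ⁻¹` without decay. The remainder uses the leftmost one for convergence and
the others for low order. -/
theorem norm_res_one_le : ∃ C : ℝ, 0 ≤ C ∧ ∀ t : ℝ, 0 < t → ∀ v : Δ.Hinf,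
    ‖Δ.res 1 t v‖ ≤ C * (1 + t)⁻¹ * ‖v‖ := by
  refine ⟨1 + ‖Δ.inv‖ / 1, by positivity, fun t ht v => Δ.norm_fc_le (by positivity) ?_ v⟩
  intro x hx
  obtain ⟨y, hy, hyN, rfl⟩ := Δ.exists_of_mem_spectrum hx
  exact norm_div_add_le ht one_pos hy hyN

theorem norm_resProd_le {M : List ℝ} (hM : ∀ μ ∈ M, 0 < μ) : ∃ C : ℝ, 0 ≤ C ∧
    ∀ t : ℝ, 0 < t → ∀ v : Δ.Hinf, ‖Δ.resProd M t v‖ ≤ C * ‖Δ.cpow (-M.length) v‖ := by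
  induction M with
  | nil => exact ⟨1, zero_le_one, fun t _ v => by simp [resProd_nil, cpow_zero]⟩
  | cons μ M ih =>
    obtain ⟨C, hC, h⟩ := ih fun μ hμ => hM μ (List.mem_cons_of_mem _ hμ)
    have hμ : 0 < μ := hM μ List.mem_cons_self
    refine ⟨μ⁻¹ * C, by positivity, fun t ht v => ?_⟩
    have e : Δ.resProd (μ :: M) t v =
        Δ.fc (fun x => ((t : ℂ) * x + μ)⁻¹) (Δ.resProd M t (Δ.cpow (-1) v)) := by
      rw [resProd_cons, Δ.res_eq ht hμ, ← Δ.cpow_neg_eq (by simp), mul_assoc,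
        ← (Δ.commute_resProd_cpow M t (-1)).eq]
      rfl
    rw [e, mul_assoc]
    refine (Δ.norm_fc_le (c := μ⁻¹) (by positivity) (fun x hx => ?_) _).trans
      (mul_le_mul_of_nonneg_left ((h t ht _).trans ?_) (by positivity))
    · obtain ⟨y, hy, -, rfl⟩ := Δ.exists_of_mem_spectrum hx
      exact norm_inv_add_le ht hμ hy
    · rw [cpow_cpow_apply, List.length_cons]
      push_cast
      rw [neg_add]

/-! ### Weak integrals of families of operators -/

/-- The family of operators `ψ` on `(0, ∞)` is weakly integrable, with integral `S`. -/
def HasWeakIntegral (ψ : ℝ → Module.End ℂ Δ.Hinf) (S : Module.End ℂ Δ.Hinf) : Prop :=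
  ∀ (w : H) (v : Δ.Hinf), IntegrableOn (fun t => ⟪w, (ψ t v : H)⟫_ℂ) (Ioi 0) ∧
    ∫ t in Ioi (0 : ℝ), ⟪w, (ψ t v : H)⟫_ℂ = ⟪w, (S v : H)⟫_ℂ

variable {Δ}

theorem HasWeakIntegral.add {ψ ψ' : ℝ → Module.End ℂ Δ.Hinf} {S S' : Module.End ℂ Δ.Hinf}
    (h : Δ.HasWeakIntegral ψ S) (h' : Δ.HasWeakIntegral ψ' S') :
    Δ.HasWeakIntegral (fun t => ψ t + ψ' t) (S + S') := by
  intro w v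
  simp only [LinearMap.add_apply, Submodule.coe_add, inner_add_right]
  exact ⟨(h w v).1.add (h' w v).1, by rw [integral_add (h w v).1 (h' w v).1, (h w v).2, (h' w v).2]⟩

theorem HasWeakIntegral.smul {ψ : ℝ → Module.End ℂ Δ.Hinf} {S : Module.End ℂ Δ.Hinf} (c : ℂ)
    (h : Δ.HasWeakIntegral ψ S) : Δ.HasWeakIntegral (fun t => c • ψ t) (c • S) := by
  intro w v
  simp only [LinearMap.smul_apply, Submodule.coe_smul, inner_smul_right]
  exact ⟨(h w v).1.const_mul c, by rw [integral_const_mul, (h w v).2]⟩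

theorem HasWeakIntegral.zero : Δ.HasWeakIntegral (fun _ => 0) 0 := by
  intro w v
  simp

/-- Norm bound for a real power of `Δ` applied to a weak integral. -/
theorem HasWeakIntegral.norm_cpow_le {ψ : ℝ → Module.End ℂ Δ.Hinf} {S : Module.End ℂ Δ.Hinf}
    (h : Δ.HasWeakIntegral ψ S) {a : ℝ} {g : ℝ → ℝ} (hg : IntegrableOn g (Ioi 0)) {v : Δ.Hinf}
    {c : ℝ} (hb : ∀ t, 0 < t → ‖Δ.cpow a (ψ t v)‖ ≤ g t * c) :
    ‖Δ.cpow a (S v)‖ ≤ (∫ t in Ioi 0, g t) * c := by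
  set u := Δ.cpow a (S v) with hu
  -- Symmetry of `Δ^a` moves it onto the fixed vector, so weak integrability of `ψ` suffices and
  -- `Δ^a ψ` needs no separate integral.
  have h1 : ⟪u, u⟫_ℂ = ∫ t in Ioi (0 : ℝ), ⟪(u : H), (Δ.cpow a (ψ t v) : H)⟫_ℂ := by
    have e : ∀ x : Δ.Hinf, ⟪(u : H), (Δ.cpow a x : H)⟫_ℂ = ⟪(Δ.cpow a u : H), (x : H)⟫_ℂ :=
      fun x => (Δ.inner_cpow_ofReal a u x).symm
    simp only [e]
    rw [(h _ v).2, ← e]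
    rfl
  have h2 : ‖u‖ * ‖u‖ ≤ ∫ t in Ioi (0 : ℝ), ‖u‖ * (g t * c) := by
    have h3 : ‖⟪u, u⟫_ℂ‖ = ‖u‖ * ‖u‖ := by
      rw [inner_self_eq_norm_sq_to_K]
      simp [pow_two]
    rw [← h3, h1]
    refine norm_integral_le_of_norm_le ((hg.mul_const c).const_mul _) ?_
    refine (ae_restrict_mem measurableSet_Ioi).mono fun t ht => ?_
    exact (norm_inner_le_norm _ _).trans (mul_le_mul_of_nonneg_left (hb t ht) (norm_nonneg _))
  rw [integral_const_mul, integral_mul_const] at h2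
  rcases (norm_nonneg u).eq_or_lt with h0 | h0
  · have h5 : 0 ≤ ∫ t in Ioi (0 : ℝ), g t * c :=
      setIntegral_nonneg measurableSet_Ioi fun t ht => (norm_nonneg _).trans (hb t ht)
    rw [integral_mul_const] at h5
    rw [← h0]
    exact h5
  · exact le_of_mul_le_mul_left h2 h0

variable (Δ)

/-- The integral converges in operator norm: the first factor of the kernel decays like `(1 + t)⁻¹`
uniformly on the spectrum, the others are bounded. It therefore commutes with the functional
calculus. -/
theorem integral_cfc_resolventKernel {z : ℂ} (h0 : 0 < z.re) (h1 : z.re < 1) {μ : ℝ} {M : List ℝ}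
    (hM : ∀ ν ∈ μ :: M, 0 < ν) {c : ℂ} (hc : ∀ x : ℝ, 0 < x →
      ∫ t in Ioi (0 : ℝ), (t : ℂ) ^ (-z) * resolventKernel (μ :: M) t x =
        c * (x : ℂ) ^ (z + M.length)) :
    IntegrableOn (fun t : ℝ => cfc (fun x => (t : ℂ) ^ (-z) * resolventKernel (μ :: M) t x) Δ.inv)
      (Ioi 0) ∧
    ∫ t in Ioi (0 : ℝ), cfc (fun x => (t : ℂ) ^ (-z) * resolventKernel (μ :: M) t x) Δ.inv =
      c • cfc (fun x : ℂ => x ^ (z + M.length)) Δ.inv := by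
  have hμ : 0 < μ := hM μ List.mem_cons_self
  have hz : 0 < (z + M.length).re := by simp; positivity
  obtain ⟨C, hC, hK⟩ := exists_norm_resolventKernel_le (norm_nonneg Δ.inv) M
    fun ν hν => hM ν (List.mem_cons_of_mem _ hν)
  have hcont : ContinuousOn (Function.uncurry fun (t : ℝ) (x : ℂ) =>
      (t : ℂ) ^ (-z) * resolventKernel (μ :: M) t x) (Ioi 0 ×ˢ spectrum ℂ Δ.inv) := by
    refine ContinuousOn.mul (fun p hp => ?_) (Δ.continuousOn_resolventKernel hM)
    have hp0 : 0 < p.1 := hp.1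
    have : ContinuousAt (fun t : ℝ => (t : ℂ) ^ (-z)) p.1 :=
      Complex.continuousAt_ofReal_cpow_const _ _ (Or.inr hp0.ne')
    exact (this.comp continuousAt_fst).continuousWithinAt
  have hbound : ∀ᵐ t : ℝ ∂(volume.restrict (Ioi (0 : ℝ))), ∀ x ∈ spectrum ℂ Δ.inv,
      ‖(t : ℂ) ^ (-z) * resolventKernel (μ :: M) t x‖ ≤
        t ^ (-z.re) / (1 + t) * ((1 + ‖Δ.inv‖ / μ) * C) := by
    refine (ae_restrict_mem measurableSet_Ioi).mono fun t ht x hx => ?_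
    have ht' : 0 < t := ht
    obtain ⟨y, hy, hyN, rfl⟩ := Δ.exists_of_mem_spectrum hx
    rw [resolventKernel_cons, norm_mul, norm_mul, Complex.norm_cpow_eq_rpow_re_of_pos ht',
      Complex.neg_re]
    calc _ ≤ t ^ (-z.re) * ((1 + ‖Δ.inv‖ / μ) * (1 + t)⁻¹ * C) := by
          gcongr
          · exact norm_div_add_le ht' hμ hy hyN
          · exact hK t y ht' hy hyN
      _ = _ := by ring
  have hint : HasFiniteIntegral (fun t : ℝ => t ^ (-z.re) / (1 + t) * ((1 + ‖Δ.inv‖ / μ) * C))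
      (volume.restrict (Ioi (0 : ℝ))) :=
    ((integrableOn_rpow_div_one_add h0 h1).mul_const _).2
  refine ⟨integrableOn_cfc measurableSet_Ioi _ _ Δ.inv hcont hbound hint, ?_⟩
  rw [← cfc_setIntegral measurableSet_Ioi _ _ Δ.inv hcont hbound hint,
    ← cfc_const_mul c _ Δ.inv (Δ.continuousOn_cpow hz)]
  refine cfc_congr fun x hx => ?_
  obtain ⟨y, hy, -, rfl⟩ := Δ.exists_of_mem_spectrum hx
  -- The scalar formula is assumed only for `x > 0`; at the spectral value `0` both sides vanish.
  rcases hy.eq_or_lt with rfl | hy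
  · simp only [resolventKernel_cons, Complex.ofReal_zero, zero_div, zero_mul, mul_zero,
      integral_zero]
    rw [Complex.zero_cpow, mul_zero]
    intro h
    simp [h] at hz
  · exact hc y hy

theorem fc_const_mul (c : ℂ) {f : ℂ → ℂ} (hf : ContinuousOn f (spectrum ℂ Δ.inv)) :
    Δ.fc (fun x => c * f x) = c • Δ.fc f := by
  ext v
  rw [coe_fc, cfc_const_mul c f Δ.inv hf]
  rfl

theorem hasWeakIntegral_mul_resProd {X : Module.End ℂ Δ.Hinf} {a : ℂ} {B : ℝ}
    (hX : ∀ v, ‖X v‖ ≤ B * ‖Δ.cpow a v‖) {z : ℂ} (h0 : 0 < z.re) (h1 : z.re < 1) {μ : ℝ}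
    {M : List ℝ} (hM : ∀ ν ∈ μ :: M, 0 < ν) {c : ℂ} (hc : ∀ x : ℝ, 0 < x →
      ∫ t in Ioi (0 : ℝ), (t : ℂ) ^ (-z) * resolventKernel (μ :: M) t x =
        c * (x : ℂ) ^ (z + M.length)) :
    Δ.HasWeakIntegral (fun t => (t : ℂ) ^ (-z) • (X * Δ.resProd (μ :: M) t))
      (c • (X * Δ.cpow (-(z + M.length)))) := by
  intro w v
  obtain ⟨hI, hI'⟩ := Δ.integral_cfc_resolventKernel h0 h1 hM hc
  have hz : 0 < (z + M.length).re := by simp; positivity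
  set u := Δ.cpow a v with hu
  let ℓ₀ : Δ.Hinf →ₗ[ℂ] ℂ := (innerSL ℂ w).toLinearMap ∘ₗ Δ.Hinf.subtype ∘ₗ X ∘ₗ Δ.cpow (-a)
  have hℓ₀ : ∀ x, ‖ℓ₀ x‖ ≤ ‖w‖ * B * ‖x‖ := fun x => by
    have h := hX (Δ.cpow (-a) x)
    rw [cpow_cpow_apply, add_neg_cancel, cpow_zero, Module.End.one_apply] at h
    refine (norm_inner_le_norm w (X (Δ.cpow (-a) x) : H)).trans ?_
    rw [mul_assoc]
    exact mul_le_mul_of_nonneg_left h (norm_nonneg _)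
  -- `X` is unbounded on `H`, but `x ↦ ⟪w, X Δ^(-a) x⟫` is bounded on `H^∞` and extends to `H` by
  -- Hahn–Banach. Evaluation at `Δ^a v` then gives a bounded functional on operators, which commutes
  -- with the norm-convergent integral.
  obtain ⟨ℓ, hℓ, -⟩ := exists_extension_norm_eq Δ.Hinf (ℓ₀.mkContinuous _ hℓ₀)
  have hℓ' : ∀ x : Δ.Hinf, ℓ x = ⟪w, (X (Δ.cpow (-a) x) : H)⟫_ℂ := fun x => hℓ x
  let Λ : (H →L[ℂ] H) →L[ℂ] ℂ := ℓ ∘L ContinuousLinearMap.apply ℂ H (u : H)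
  have hΛ : ∀ f : ℂ → ℂ, Λ (cfc f Δ.inv) = ⟪w, (X (Δ.fc f v) : H)⟫_ℂ := fun f => by
    have h : Δ.fc f u = Δ.cpow a (Δ.fc f v) := by
      rw [hu, ← Module.End.mul_apply, (Δ.commute_fc_cpow f a).eq, Module.End.mul_apply]
    change ℓ (Δ.fc f u) = _
    rw [hℓ', h, cpow_cpow_apply, neg_add_cancel, cpow_zero, Module.End.one_apply]
  have e : EqOn (fun t : ℝ => Λ (cfc (fun x => (t : ℂ) ^ (-z) * resolventKernel (μ :: M) t x) Δ.inv))
      (fun t : ℝ => ⟪w, (((t : ℂ) ^ (-z) • (X * Δ.resProd (μ :: M) t)) v : H)⟫_ℂ) (Ioi 0) := by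
    intro t ht
    simp only [hΛ]
    rw [Δ.fc_const_mul _ (Δ.continuousOn_resolventKernel_right hM ht), ← Δ.resProd_eq hM ht,
      LinearMap.smul_apply, LinearMap.smul_apply, map_smul]
    rfl
  refine ⟨IntegrableOn.congr_fun (Λ.integrable_comp hI) e measurableSet_Ioi, ?_⟩
  rw [← setIntegral_congr_fun measurableSet_Ioi e, Λ.integral_comp_comm hI, hI', map_smul, hΛ,
    LinearMap.smul_apply, Submodule.coe_smul, inner_smul_right, cpow_neg_eq _ hz]
  rfl

end AbstractLaplacian

/-! ### Eigenvectors in invariant subspaces -/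

section Eigenvectors

variable {K V : Type*} [Field K] [AddCommGroup V] [Module K V]

/-- Applying `f - a` to the sum kills the component of eigenvalue `a` and multiplies the others by
nonzero scalars, so induction applies. -/
theorem Submodule.mem_of_sum_eigenvectors_mem {f : Module.End K V} {p : Submodule K V}
    (hp : ∀ x ∈ p, f x ∈ p) (s : Finset K) (x : K → V) (hx : ∀ μ ∈ s, f (x μ) = μ • x μ)
    (hsum : ∑ μ ∈ s, x μ ∈ p) : ∀ μ ∈ s, x μ ∈ p := by
  classical
  induction s using Finset.induction_on generalizing x with
  | empty => simp
  | insert a s ha ih =>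
    have hs : ∀ μ ∈ s, x μ ∈ p := by
      have h1 : ∑ μ ∈ s, (μ - a) • x μ ∈ p := by
        have h2 := p.sub_mem (hp _ hsum) (p.smul_mem a hsum)
        rw [map_sum, Finset.smul_sum, ← Finset.sum_sub_distrib, Finset.sum_insert ha,
          hx a (Finset.mem_insert_self _ _), sub_self, zero_add] at h2
        convert h2 using 1
        refine Finset.sum_congr rfl fun μ hμ => ?_
        rw [hx μ (Finset.mem_insert_of_mem hμ), sub_smul]
      intro μ hμ
      have h3 := ih (fun μ => (μ - a) • x μ) (fun μ hμ => by
        rw [map_smul, hx μ (Finset.mem_insert_of_mem hμ), smul_comm]) h1 μ hμ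
      have hne : μ - a ≠ 0 := sub_ne_zero.2 fun h => ha (h ▸ hμ)
      simpa [smul_smul, inv_mul_cancel₀ hne] using p.smul_mem (μ - a)⁻¹ h3
    intro μ hμ
    rcases Finset.mem_insert.1 hμ with rfl | hμ
    · rw [Finset.sum_insert ha] at hsum
      simpa using p.sub_mem hsum (p.sum_mem hs)
    · exact hs μ hμ

theorem Submodule.mem_span_eigenvectors {f : Module.End K V} {p : Submodule K V}
    (hp : ∀ x ∈ p, f x ∈ p) (hf : ⨆ μ, Module.End.eigenspace f μ = ⊤) {x : V} (hx : x ∈ p) :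
    x ∈ Submodule.span K {y | y ∈ p ∧ ∃ μ, f.HasEigenvalue μ ∧ f y = μ • y} := by
  obtain ⟨y, hy, rfl⟩ := (Submodule.mem_iSup_iff_exists_finsupp _ _).1
    (hf.symm ▸ Submodule.mem_top : x ∈ ⨆ μ, Module.End.eigenspace f μ)
  have hy' : ∀ μ, f (y μ) = μ • y μ := fun μ => Module.End.mem_eigenspace_iff.1 (hy μ)
  refine Submodule.sum_mem _ fun μ hμ => Submodule.subset_span ⟨?_, μ, ?_, hy' μ⟩
  · exact Submodule.mem_of_sum_eigenvectors_mem hp y.support y (fun μ _ => hy' μ) hx μ hμ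
  · exact Module.End.hasEigenvalue_of_hasEigenvector ⟨hy μ, Finsupp.mem_support_iff.1 hμ⟩

end Eigenvectors

/-! ### Expansion of `Δ^(-z) X` by iterated resolvent commutators. -/

section Expansion

open AbstractLaplacian MeasureTheory Set

variable {H : Type*} [NormedAddCommGroup H] [InnerProductSpace ℂ H] [CompleteSpace H]
variable {Δ : AbstractLaplacian H} {r : ℕ} (𝒟 : TwistedDO Δ r)

namespace TwistedDO

theorem filt_le_alg {m : ℕ} {X : Module.End ℂ Δ.Hinf} (hX : X ∈ 𝒟.filt m) : X ∈ 𝒟.alg :=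
  (𝒟.exhaustive X).2 ⟨m, hX⟩

/-- The eigenvectors of the twisting in `𝒟^m`, for positive eigenvalues `ν`. -/
def IsEigen (m : ℕ) (ν : ℝ) (X : Module.End ℂ Δ.Hinf) : Prop :=
  X ∈ 𝒟.filt m ∧ 0 < ν ∧ ∃ h : X ∈ 𝒟.alg, 𝒟.θ ⟨X, h⟩ = (ν : ℂ) • ⟨X, h⟩

/-- As `𝒟^m` is invariant under `θ`, the eigencomponents of `X` do not leave `𝒟^m`. -/
theorem mem_span_isEigen (hdiag : IsDiagonalizableEnd (V := 𝒟.alg) (𝒟.θ : Module.End ℂ 𝒟.alg))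
    (hpos : HasPositiveSpectrum (V := 𝒟.alg) (𝒟.θ : Module.End ℂ 𝒟.alg)) {m : ℕ} {X : Module.End ℂ Δ.Hinf}
    (hX : X ∈ 𝒟.filt m) : X ∈ Submodule.span ℂ {Y | ∃ ν, 𝒟.IsEigen m ν Y} := by
  obtain ⟨p, hp⟩ : ∃ p : Submodule ℂ 𝒟.alg, ∀ X, X ∈ p ↔ (X : Module.End ℂ Δ.Hinf) ∈ 𝒟.filt m :=
    ⟨{ carrier := {X | (X : Module.End ℂ Δ.Hinf) ∈ 𝒟.filt m}
       add_mem' := fun h h' => (𝒟.filt m).add_mem h h'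
       zero_mem' := (𝒟.filt m).zero_mem
       smul_mem' := fun c _ h => (𝒟.filt m).smul_mem c h }, fun _ => Iff.rfl⟩
  obtain ⟨ι, hι⟩ : ∃ ι : 𝒟.alg →ₗ[ℂ] Module.End ℂ Δ.Hinf, ∀ X : 𝒟.alg, ι X = X :=
    ⟨{ toFun := Subtype.val
       map_add' := fun _ _ => rfl
       map_smul' := fun _ _ => rfl }, fun _ => rfl⟩
  have h := Submodule.mem_span_eigenvectors (K := ℂ) (V := 𝒟.alg)
    (f := (𝒟.θ : Module.End ℂ 𝒟.alg)) (p := p)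
    (fun Y hY => by rw [hp] at hY ⊢; exact (𝒟.θ_mem_filt m Y).2 hY) hdiag.2
    ((hp ⟨X, 𝒟.filt_le_alg hX⟩).2 hX)
  have h1 := Submodule.mem_map_of_mem (f := ι) h
  rw [Submodule.map_span, hι] at h1
  refine Submodule.span_mono ?_ h1
  rintro _ ⟨Y, ⟨hY, μ, hμ, hθ⟩, rfl⟩
  obtain ⟨c, hc, rfl⟩ := hpos μ hμ.mem_spectrum
  rw [hι]
  exact ⟨c, (hp Y).1 hY, hc, Y.2, hθ⟩

variable {𝒟}

theorem IsEigen.commutator_mem {m : ℕ} {ν : ℝ} {X : Module.End ℂ Δ.Hinf}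
    (hX : 𝒟.IsEigen m ν X) :
    Δ.lap * X - ((ν ^ r : ℝ) : ℂ) • (X * Δ.lap) ∈ 𝒟.filt (m + r - 1) := by
  obtain ⟨hm, -, h, hθ⟩ := hX
  have key : ∀ n : ℕ, (𝒟.θ ^ n) ⟨X, h⟩ = ((ν ^ n : ℝ) : ℂ) • ⟨X, h⟩ := by
    intro n
    induction n with
    | zero => simp
    | succ n ih =>
      rw [pow_succ', LinearEquiv.mul_apply, ih, map_smul, hθ, smul_smul]
      push_cast
      rw [pow_succ]
  have h1 := 𝒟.twisted_commutator m ⟨X, h⟩ hm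
  rw [key r] at h1
  simpa [smul_mul_assoc] using! h1

variable (𝒟)

/-- Elements of `𝒟^m` map the Sobolev space of degree `a + m` to the one of degree `a`. -/
def BoundedAt (a : ℝ) : Prop :=
  ∀ m : ℕ, ∀ X ∈ 𝒟.filt m, ∃ C : ℝ, 0 ≤ C ∧ ∀ v : Δ.Hinf,
    ‖Δ.dpow r a (X v)‖ ≤ C * ‖Δ.dpow r (a + m) v‖

theorem boundedAt_zero : 𝒟.BoundedAt 0 := by
  intro m X hX
  obtain ⟨C, hC, h⟩ := 𝒟.elliptic_estimate m X hX
  refine ⟨C, hC.le, fun v => ?_⟩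
  rw [Complex.ofReal_zero, dpow_zero, zero_add]
  exact h v

theorem mul_dpow_mem_basicOperators {m : ℕ} {X : Module.End ℂ Δ.Hinf} (hX : X ∈ 𝒟.filt m) {z : ℂ}
    {t : ℝ} (h : z.re + m ≤ t) : X * Δ.dpow r z ∈ 𝒟.basicOperators t :=
  ⟨m, z + m, X, hX, by simpa using h, by rw [add_sub_cancel_right]; rfl⟩

theorem basicOperators_mono : Monotone 𝒟.basicOperators := by
  rintro s t hst _ ⟨m, z, X, hX, hz, rfl⟩
  exact ⟨m, z, X, hX, hz.trans hst, rfl⟩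

variable {𝒟}

theorem BoundedAt.norm_basicOperators_le {a : ℝ} (ha : 𝒟.BoundedAt a) {t : ℝ}
    {S : Module.End ℂ Δ.Hinf} (hS : S ∈ Submodule.span ℂ (𝒟.basicOperators t)) :
    ∃ C : ℝ, 0 ≤ C ∧ ∀ v : Δ.Hinf, ‖Δ.dpow r a (S v)‖ ≤ C * ‖Δ.dpow r (a + t) v‖ := by
  induction hS using Submodule.span_induction with
  | mem S hS =>
    obtain ⟨m, z, X, hX, hz, rfl⟩ := hS
    obtain ⟨C, hC, h⟩ := ha m X hX
    obtain ⟨C', hC', h'⟩ := Δ.exists_norm_dpow_le r (z := a + m + (z - m)) (w := a + t) (by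
      simpa using hz)
    refine ⟨C * C', by positivity, fun v => ?_⟩
    rw [mul_assoc]
    refine (h _).trans (mul_le_mul_of_nonneg_left ?_ hC)
    change ‖Δ.dpow r (a + m) (Δ.dpow r (z - m) v)‖ ≤ _
    rw [dpow_dpow_apply]
    exact h' v
  | zero => exact ⟨0, le_rfl, fun v => by simp⟩
  | add S S' _ _ h h' =>
    obtain ⟨C, hC, h⟩ := h
    obtain ⟨C', hC', h'⟩ := h'
    refine ⟨C + C', by positivity, fun v => ?_⟩
    rw [LinearMap.add_apply, map_add, add_mul]
    exact (norm_add_le _ _).trans (add_le_add (h v) (h' v))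
  | smul c S _ h =>
    obtain ⟨C, hC, h⟩ := h
    refine ⟨‖c‖ * C, by positivity, fun v => ?_⟩
    rw [LinearMap.smul_apply, map_smul, mul_assoc]
    exact (norm_smul_le _ _).trans (mul_le_mul_of_nonneg_left (h v) (norm_nonneg _))

variable (𝒟)

/-- The integral over `(0, ∞)` of the family `φ` is, up to an operator of order `l` for the Sobolev
degrees in `s`, a sum of basic operators of order `t`. -/
def HasExpansion (s : Set ℝ) (l t : ℝ) (φ : ℝ → Module.End ℂ Δ.Hinf) : Prop :=
  ∃ S ∈ Submodule.span ℂ (𝒟.basicOperators t), ∃ ψ : ℝ → Module.End ℂ Δ.Hinf,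
    Δ.HasWeakIntegral ψ S ∧ ∀ a ∈ s, ∃ g : ℝ → ℝ, IntegrableOn g (Ioi 0) ∧
      ∀ τ, 0 < τ → ∀ v : Δ.Hinf,
        ‖Δ.dpow r a ((φ τ - ψ τ) v)‖ ≤ g τ * ‖Δ.dpow r (a + l) v‖

variable {𝒟} {s : Set ℝ} {l t : ℝ} {φ φ' : ℝ → Module.End ℂ Δ.Hinf}

theorem HasExpansion.add (h : 𝒟.HasExpansion s l t φ) (h' : 𝒟.HasExpansion s l t φ') :
    𝒟.HasExpansion s l t (fun τ => φ τ + φ' τ) := by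
  obtain ⟨S, hS, ψ, hψ, h⟩ := h
  obtain ⟨S', hS', ψ', hψ', h'⟩ := h'
  refine ⟨S + S', Submodule.add_mem _ hS hS', _, hψ.add hψ', fun a ha => ?_⟩
  obtain ⟨g, hg, h⟩ := h a ha
  obtain ⟨g', hg', h'⟩ := h' a ha
  refine ⟨fun τ => g τ + g' τ, hg.add hg', fun τ hτ v => ?_⟩
  rw [add_sub_add_comm, LinearMap.add_apply, map_add, add_mul]
  exact (norm_add_le _ _).trans (add_le_add (h τ hτ v) (h' τ hτ v))

theorem HasExpansion.smul (c : ℂ) (h : 𝒟.HasExpansion s l t φ) :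
    𝒟.HasExpansion s l t (fun τ => c • φ τ) := by
  obtain ⟨S, hS, ψ, hψ, h⟩ := h
  refine ⟨c • S, Submodule.smul_mem _ c hS, _, hψ.smul c, fun a ha => ?_⟩
  obtain ⟨g, hg, h⟩ := h a ha
  refine ⟨fun τ => ‖c‖ * g τ, hg.const_mul _, fun τ hτ v => ?_⟩
  have e : c • φ τ - c • ψ τ = c • (φ τ - ψ τ) := by module
  beta_reduce
  rw [e, LinearMap.smul_apply, map_smul, mul_assoc]
  exact (norm_smul_le _ _).trans (mul_le_mul_of_nonneg_left (h τ hτ v) (norm_nonneg _))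

theorem HasExpansion.congr (h : 𝒟.HasExpansion s l t φ) (e : ∀ τ, 0 < τ → φ τ = φ' τ) :
    𝒟.HasExpansion s l t φ' := by
  obtain ⟨S, hS, ψ, hψ, h⟩ := h
  refine ⟨S, hS, ψ, hψ, fun a ha => ?_⟩
  obtain ⟨g, hg, h⟩ := h a ha
  exact ⟨g, hg, fun τ hτ v => by rw [← e τ hτ]; exact h τ hτ v⟩

theorem HasExpansion.mono {t' : ℝ} (h : 𝒟.HasExpansion s l t φ) (htt' : t ≤ t') :
    𝒟.HasExpansion s l t' φ := by
  obtain ⟨S, hS, h⟩ := h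
  exact ⟨S, Submodule.span_mono (𝒟.basicOperators_mono htt') hS, h⟩

theorem hasExpansion_of_hasWeakIntegral {S : Module.End ℂ Δ.Hinf}
    (hS : S ∈ Submodule.span ℂ (𝒟.basicOperators t)) (h : Δ.HasWeakIntegral φ S) :
    𝒟.HasExpansion s l t φ :=
  ⟨S, hS, φ, h, fun _ _ => ⟨fun _ => 0, integrableOn_zero, fun τ _ v => by simp⟩⟩

theorem hasExpansion_zero : 𝒟.HasExpansion s l t fun _ => 0 :=
  hasExpansion_of_hasWeakIntegral (zero_mem _) HasWeakIntegral.zero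

theorem dpow_eq_cpow_ofReal (Δ : AbstractLaplacian H) (r : ℕ) (a : ℝ) :
    Δ.dpow r a = Δ.cpow ((a / r : ℝ) : ℂ) := by
  rw [dpow]
  push_cast
  rfl

/-- The bound for the remainder after sufficiently many commutators. -/
theorem hasExpansion_of_order_le (hs : ∀ a ∈ s, 𝒟.BoundedAt a) (hr : r ≠ 0) {z : ℂ}
    (h0 : 0 < z.re) (h1 : z.re < 1) {m : ℕ} {M : List ℝ} {X : Module.End ℂ Δ.Hinf}
    (hm : (m : ℝ) - r * M.length ≤ l) (hX : X ∈ 𝒟.filt m) (hM : ∀ μ ∈ M, 0 < μ) :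
    𝒟.HasExpansion s l t fun τ => (τ : ℂ) ^ (-z) • (Δ.res 1 τ * X * Δ.resProd M τ) := by
  refine ⟨0, zero_mem _, fun _ => 0, HasWeakIntegral.zero, fun a ha => ?_⟩
  obtain ⟨C₀, hC₀, hres⟩ := Δ.norm_res_one_le
  obtain ⟨C₁, hC₁, hX'⟩ := hs a ha m X hX
  obtain ⟨C₂, hC₂, hprod⟩ := Δ.norm_resProd_le hM
  obtain ⟨C₃, hC₃, hle⟩ := Δ.exists_norm_dpow_le r (z := r * (-M.length) + (a + m)) (w := a + l) (by
    simp
    linarith)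
  refine ⟨fun τ => τ ^ (-z.re) / (1 + τ) * (C₀ * C₁ * C₂ * C₃),
    (integrableOn_rpow_div_one_add h0 h1).mul_const _, fun τ hτ v => ?_⟩
  -- The resolvents commute with powers of `Δ`, so boundedness of `X` at the single degree `a` is
  -- all that is needed.
  have e1 : Δ.dpow r a (((τ : ℂ) ^ (-z) • (Δ.res 1 τ * X * Δ.resProd M τ) - 0) v) =
      (τ : ℂ) ^ (-z) • Δ.res 1 τ (Δ.dpow r a (X (Δ.resProd M τ v))) := by
    have h := LinearMap.congr_fun (Δ.commute_res_cpow 1 τ (a / r)).eq (X (Δ.resProd M τ v))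
    rw [sub_zero, LinearMap.smul_apply, map_smul]
    exact congrArg _ h.symm
  have e2 : Δ.dpow r (a + m) (Δ.resProd M τ v) = Δ.resProd M τ (Δ.dpow r (a + m) v) :=
    (LinearMap.congr_fun (Δ.commute_resProd_cpow M τ ((a + m) / r)).eq v).symm
  have h2 : ‖Δ.resProd M τ (Δ.dpow r (a + m) v)‖ ≤ C₂ * (C₃ * ‖Δ.dpow r (a + l) v‖) := by
    refine (hprod τ hτ _).trans (mul_le_mul_of_nonneg_left ?_ hC₂)
    rw [← Δ.dpow_mul_nat hr, dpow_dpow_apply]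
    exact hle v
  rw [e1, norm_smul, Complex.norm_cpow_eq_rpow_re_of_pos hτ, Complex.neg_re]
  have h3 := hX' (Δ.resProd M τ v)
  rw [e2] at h3
  calc _ ≤ τ ^ (-z.re) * (C₀ * (1 + τ)⁻¹ * (C₁ * (C₂ * (C₃ * ‖Δ.dpow r (a + l) v‖)))) := by
        gcongr
        refine (hres τ hτ _).trans (mul_le_mul_of_nonneg_left ?_ (by positivity))
        exact h3.trans (mul_le_mul_of_nonneg_left h2 hC₁)
    _ = _ := by ring

theorem IsEigen.hasWeakIntegral {m : ℕ} {ν : ℝ} {X : Module.End ℂ Δ.Hinf} (hX : 𝒟.IsEigen m ν X)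
    {z : ℂ} (h0 : 0 < z.re) (h1 : z.re < 1) {μ : ℝ} {M : List ℝ} (hM : ∀ ν ∈ μ :: M, 0 < ν) {c : ℂ}
    (hc : ∀ x : ℝ, 0 < x →
      ∫ t in Ioi (0 : ℝ), (t : ℂ) ^ (-z) * resolventKernel (μ :: M) t x =
        c * (x : ℂ) ^ (z + M.length)) :
    Δ.HasWeakIntegral (fun t => (t : ℂ) ^ (-z) • (X * Δ.resProd (μ :: M) t))
      (c • (X * Δ.cpow (-(z + M.length)))) := by
  obtain ⟨C, -, h⟩ := 𝒟.elliptic_estimate m X hX.1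
  exact Δ.hasWeakIntegral_mul_resProd h h0 h1 hM hc

theorem IsEigen.res_one_mul_mul_resProd {m : ℕ} {ν : ℝ} {X : Module.End ℂ Δ.Hinf}
    (hX : 𝒟.IsEigen m ν X) (M : List ℝ) {τ : ℝ} (hτ : 0 < τ) :
    Δ.res 1 τ * X * Δ.resProd M τ = X * Δ.resProd (ν ^ r :: M) τ -
      Δ.res 1 τ * (Δ.lap * X - ((ν ^ r : ℝ) : ℂ) • (X * Δ.lap)) * Δ.resProd (ν ^ r :: M) τ := by
  rw [Δ.res_one_mul (pow_pos hX.2.1 r) rfl hτ, resProd_cons, sub_mul]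
  simp only [mul_assoc]

/-- `N` bounds the excess of the order `m - r * M.length` over the target `l`. A round of
`IsEigen.res_one_mul_mul_resProd` leaves a term with explicit integral and a remainder with excess
smaller by one. The commutator need not be an eigenvector, so it is decomposed again each time. -/
theorem hasExpansion_res_mul (hr : r ≠ 0) (hdiag : IsDiagonalizableEnd (V := 𝒟.alg) (𝒟.θ : Module.End ℂ 𝒟.alg))
    (hpos : HasPositiveSpectrum (V := 𝒟.alg) (𝒟.θ : Module.End ℂ 𝒟.alg))
    (hs : ∀ a ∈ s, 𝒟.BoundedAt a) {z : ℂ} (h0 : 0 < z.re)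
    (h1 : z.re < 1) (N : ℕ) : ∀ (m : ℕ) (M : List ℝ) (X : Module.End ℂ Δ.Hinf),
    (m : ℝ) - r * M.length ≤ l + N → X ∈ 𝒟.filt m → (∀ μ ∈ M, 0 < μ) →
    𝒟.HasExpansion s l (m - r * (z.re + M.length))
      fun τ => (τ : ℂ) ^ (-z) • (Δ.res 1 τ * X * Δ.resProd M τ) := by
  induction N with
  | zero =>
    intro m M X hm hX hM
    exact hasExpansion_of_order_le hs hr h0 h1 (by simpa using hm) hX hM
  | succ N ih =>
    intro m M X hm hX hM
    have hspan := 𝒟.mem_span_isEigen hdiag hpos hX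
    clear hX
    induction hspan using Submodule.span_induction with
    | mem X hX =>
      obtain ⟨ν, hX⟩ := hX
      have hM' : ∀ μ ∈ ν ^ r :: M, 0 < μ := by
        intro μ hμ
        rcases List.mem_cons.1 hμ with rfl | hμ
        · exact pow_pos hX.2.1 r
        · exact hM μ hμ
      have hcast : ((m + r - 1 : ℕ) : ℝ) = m + r - 1 := by
        rw [Nat.cast_sub (by omega)]
        push_cast
        ring
      have hlen : ((ν ^ r :: M).length : ℝ) = M.length + 1 := by simp
      have hY := ih (m + r - 1) (ν ^ r :: M) _ (by
        rw [hcast, hlen]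
        push_cast at hm
        linarith) hX.commutator_mem hM'
      have hXM := hX.hasWeakIntegral h0 h1 hM'
        (fun x hx => integral_resolventKernel z (ν ^ r) M hx)
      have h2 : 𝒟.HasExpansion s l (m - r * (z.re + M.length)) _ :=
        hasExpansion_of_hasWeakIntegral (Submodule.smul_mem _ _ (Submodule.subset_span (by
          rw [← Δ.dpow_mul_nat hr]
          refine 𝒟.mul_dpow_mem_basicOperators hX.1 ?_
          simp
          linarith))) hXM
      have h3 : 𝒟.HasExpansion s l (m - r * (z.re + M.length)) _ := (hY.smul (-1)).mono (by
        rw [hcast, hlen]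
        linarith)
      refine (h2.add h3).congr fun τ hτ => ?_
      rw [hX.res_one_mul_mul_resProd M hτ, smul_sub]
      module
    | zero => simpa using! hasExpansion_zero
    | add X Y _ _ hX hY =>
      refine (hX.add hY).congr fun τ _ => ?_
      rw [mul_add, add_mul, smul_add]
    | smul c X _ hX =>
      refine (hX.smul c).congr fun τ _ => ?_
      rw [mul_smul_comm, smul_mul_assoc, smul_comm]

/-- Integrating the resolvent identity gives `c (Δ^(-z) X - μ^(-z) X Δ^(-z))` on one side, with `μ =
ν^r`, and minus the expanded integral involving `Y` on the other. Since `S` has order one less than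
the leading term, the leading coefficient is visible. -/
theorem IsEigen.exists_cpow_neg_mul (hr : r ≠ 0) (hdiag : IsDiagonalizableEnd (V := 𝒟.alg) (𝒟.θ : Module.End ℂ 𝒟.alg))
    (hpos : HasPositiveSpectrum (V := 𝒟.alg) (𝒟.θ : Module.End ℂ 𝒟.alg))
    (hs : ∀ a ∈ s, 𝒟.BoundedAt a) {z : ℂ} (h0 : 0 < z.re)
    (h1 : z.re < 1) (l : ℝ) {m : ℕ} {ν : ℝ} {X : Module.End ℂ Δ.Hinf} (hX : 𝒟.IsEigen m ν X) :
    ∃ S ∈ Submodule.span ℂ (𝒟.basicOperators (m - r * z.re - 1)), ∀ a ∈ s, ∃ C : ℝ,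
      ∀ v : Δ.Hinf, ‖Δ.dpow r a ((Δ.cpow (-z) * X -
        ((ν ^ r : ℝ) : ℂ) ^ (-z) • (X * Δ.cpow (-z)) - S) v)‖ ≤ C * ‖Δ.dpow r (a + l) v‖ := by
  set Y := Δ.lap * X - ((ν ^ r : ℝ) : ℂ) • (X * Δ.lap) with hYdef
  set c := ∫ t in Ioi (0 : ℝ), (t : ℂ) ^ (-z) / (t + 1) with hcdef
  have hc : c ≠ 0 := integral_cpow_div_one_add_ne_zero h0 h1
  have hν : 0 < ν ^ r := pow_pos hX.2.1 r
  obtain ⟨N, hN⟩ := exists_nat_ge ((m : ℝ) - l)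
  have hcast : ((m + r - 1 : ℕ) : ℝ) = m + r - 1 := by
    rw [Nat.cast_sub (by omega)]
    push_cast
    ring
  obtain ⟨S, hS, ψ, hψ, hbound⟩ := hasExpansion_res_mul (l := l) hr hdiag hpos hs h0 h1 N
    (m + r - 1) [ν ^ r] Y (by
      rw [hcast]
      simp
      linarith) hX.commutator_mem (by simpa using hν)
  have hleft : Δ.HasWeakIntegral (fun τ => (τ : ℂ) ^ (-z) • (Δ.res 1 τ * X))
      (c • (Δ.cpow (-z) * X)) := by
    have h := Δ.hasWeakIntegral_mul_resProd (X := 1) (a := 0) (B := 1)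
      (fun v => by rw [cpow_zero]; simp) h0 h1 (μ := 1) (M := []) (by simp) (c := c)
      (fun x hx => by
        have := integral_resolventKernel_singleton z one_pos hx
        simpa using this)
    intro w v
    have h2 := h w (X v)
    simpa [resProd_cons, resProd_nil] using! h2
  have hright := hX.hasWeakIntegral h0 h1 (μ := ν ^ r) (M := []) (by simpa using hν)
    (c := c * ((ν ^ r : ℝ) : ℂ) ^ (-z))
    (fun x hx => by
      simpa using integral_resolventKernel_singleton z hν hx)
  -- Pointwise this family is minus the expansion error, which `g` dominates; its weak integral is
  -- `c` times the operator to be estimated.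
  have htot := (hleft.add (hright.smul (-1))).add hψ
  refine ⟨-c⁻¹ • S, Submodule.smul_mem _ _ (Submodule.span_mono (𝒟.basicOperators_mono ?_) hS),
    fun a ha => ?_⟩
  · rw [hcast]
    simp
    linarith
  obtain ⟨g, hg, hb⟩ := hbound a ha
  refine ⟨‖c⁻¹‖ * ∫ τ in Ioi 0, g τ, fun v => ?_⟩
  have hfin := htot.norm_cpow_le (a := a / r) hg (v := v) (c := ‖Δ.dpow r (a + l) v‖) (by
    intro τ hτ
    rw [← dpow_eq_cpow_ofReal]
    have e : ((τ : ℂ) ^ (-z) • (Δ.res 1 τ * X) +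
        (-1 : ℂ) • (τ : ℂ) ^ (-z) • (X * Δ.resProd [ν ^ r] τ) + ψ τ) =
        -((τ : ℂ) ^ (-z) • (Δ.res 1 τ * Y * Δ.resProd [ν ^ r] τ) - ψ τ) := by
      have := hX.res_one_mul_mul_resProd [] hτ
      rw [resProd_nil, mul_one] at this
      rw [this, smul_sub]
      module
    rw [e, LinearMap.neg_apply, map_neg, norm_neg]
    exact hb τ hτ v)
  rw [← dpow_eq_cpow_ofReal] at hfin
  have e : Δ.cpow (-z) * X - ((ν ^ r : ℝ) : ℂ) ^ (-z) • (X * Δ.cpow (-z)) - -c⁻¹ • S =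
      c⁻¹ • (c • (Δ.cpow (-z) * X) + (-1 : ℂ) • (c * ((ν ^ r : ℝ) : ℂ) ^ (-z)) •
        (X * Δ.cpow (-(z + ([] : List ℝ).length))) + S) := by
    rw [List.length_nil, Nat.cast_zero, add_zero, smul_add, smul_add, smul_smul, smul_smul,
      smul_smul, inv_mul_cancel₀ hc, one_smul,
      show c⁻¹ * -1 * (c * ((ν ^ r : ℝ) : ℂ) ^ (-z)) = -(((ν ^ r : ℝ) : ℂ) ^ (-z)) by
        field_simp]
    module
  rw [e, LinearMap.smul_apply, map_smul, norm_smul, mul_assoc]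
  exact mul_le_mul_of_nonneg_left hfin (norm_nonneg _)

end TwistedDO

end Expansion

namespace AbstractLaplacian

variable {H : Type*} [NormedAddCommGroup H] [InnerProductSpace ℂ H] [CompleteSpace H]
variable {Δ : AbstractLaplacian H} {r : ℕ} {s t : ℝ} {T U : Module.End ℂ Δ.Hinf}

/-! ### Operators of given analytic order -/

/-- Indexing by the target degree `a` instead of the source degree makes composition and `BoundedAt`
fit directly. -/
theorem isOp_iff : Δ.IsOp r t T ↔ ∀ a : ℝ, ∃ C : ℝ, 0 ≤ C ∧ ∀ v : Δ.Hinf,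
    ‖Δ.dpow r a (T v)‖ ≤ C * ‖Δ.dpow r (a + t) v‖ := by
  constructor
  · intro h a
    obtain ⟨C, h⟩ := h (a + t)
    refine ⟨|C|, abs_nonneg C, fun v => ?_⟩
    have h1 := h v
    rw [add_sub_cancel_right, sobolevNorm, sobolevNorm, Complex.ofReal_add] at h1
    exact h1.trans (mul_le_mul_of_nonneg_right (le_abs_self C) (norm_nonneg _))
  · intro h a
    obtain ⟨C, -, h⟩ := h (a - t)
    refine ⟨C, fun v => ?_⟩
    have h1 := h v
    rw [← Complex.ofReal_add, sub_add_cancel] at h1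
    exact h1

theorem IsOp.add (hT : Δ.IsOp r t T) (hU : Δ.IsOp r t U) : Δ.IsOp r t (T + U) := by
  rw [isOp_iff] at *
  intro a
  obtain ⟨C, hC, hT⟩ := hT a
  obtain ⟨C', hC', hU⟩ := hU a
  refine ⟨C + C', by positivity, fun v => ?_⟩
  rw [LinearMap.add_apply, map_add, add_mul]
  exact (norm_add_le _ _).trans (add_le_add (hT v) (hU v))

theorem IsOp.smul (c : ℂ) (hT : Δ.IsOp r t T) : Δ.IsOp r t (c • T) := by
  rw [isOp_iff] at *
  intro a
  obtain ⟨C, hC, hT⟩ := hT a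
  refine ⟨‖c‖ * C, by positivity, fun v => ?_⟩
  rw [LinearMap.smul_apply, map_smul, mul_assoc]
  exact (norm_smul_le _ _).trans (mul_le_mul_of_nonneg_left (hT v) (norm_nonneg _))

theorem isOp_zero : Δ.IsOp r t 0 :=
  isOp_iff.2 fun _ => ⟨0, le_rfl, fun v => by simp⟩

theorem IsOp.mul (hT : Δ.IsOp r s T) (hU : Δ.IsOp r t U) : Δ.IsOp r (s + t) (T * U) := by
  rw [isOp_iff] at *
  intro a
  obtain ⟨C, hC, hT⟩ := hT a
  obtain ⟨C', hC', hU⟩ := hU (a + s)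
  refine ⟨C * C', by positivity, fun v => (hT _).trans ?_⟩
  have h := hU v
  push_cast at h ⊢
  rw [mul_assoc, ← add_assoc]
  exact mul_le_mul_of_nonneg_left h hC

theorem isOp_dpow (z : ℂ) : Δ.IsOp r z.re (Δ.dpow r z) := by
  rw [isOp_iff]
  intro a
  refine ⟨1, zero_le_one, fun v => ?_⟩
  rw [dpow_dpow_apply, one_mul]
  exact (Δ.norm_dpow_eq r (by simp) v).le

end AbstractLaplacian

namespace TwistedDO

open AbstractLaplacian

variable {H : Type*} [NormedAddCommGroup H] [InnerProductSpace ℂ H] [CompleteSpace H]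
variable {Δ : AbstractLaplacian H} {r : ℕ} {𝒟 : TwistedDO Δ r}

/-! ### Sobolev continuity of differential operators -/

theorem exists_cpow_neg_mul (hr : r ≠ 0)
    (hdiag : IsDiagonalizableEnd (V := 𝒟.alg) (𝒟.θ : Module.End ℂ 𝒟.alg))
    (hpos : HasPositiveSpectrum (V := 𝒟.alg) (𝒟.θ : Module.End ℂ 𝒟.alg))
    {s : Set ℝ} (hs : ∀ a ∈ s, 𝒟.BoundedAt a) {z : ℂ} (h0 : 0 < z.re)
    (h1 : z.re < 1) (l : ℝ) {m : ℕ} {X : Module.End ℂ Δ.Hinf} (hX : X ∈ 𝒟.filt m) :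
    ∃ S ∈ Submodule.span ℂ (𝒟.basicOperators (m - r * z.re)), ∀ a ∈ s, ∃ C : ℝ,
      ∀ v : Δ.Hinf, ‖Δ.dpow r a ((Δ.cpow (-z) * X - S) v)‖ ≤ C * ‖Δ.dpow r (a + l) v‖ := by
  have hspan := 𝒟.mem_span_isEigen hdiag hpos hX
  clear hX
  induction hspan using Submodule.span_induction with
  | mem X hX =>
    obtain ⟨ν, hX⟩ := hX
    obtain ⟨S, hS, h⟩ := hX.exists_cpow_neg_mul hr hdiag hpos hs h0 h1 l
    refine ⟨((ν ^ r : ℝ) : ℂ) ^ (-z) • (X * Δ.cpow (-z)) + S, Submodule.add_mem _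
      (Submodule.smul_mem _ _ (Submodule.subset_span ?_))
      (Submodule.span_mono (𝒟.basicOperators_mono (by linarith)) hS), fun a ha => ?_⟩
    · rw [← Δ.dpow_mul_nat hr]
      refine 𝒟.mul_dpow_mem_basicOperators hX.1 ?_
      simp
    · rw [← sub_sub]
      exact h a ha
  | zero => exact ⟨0, zero_mem _, fun a _ => ⟨0, fun v => by simp⟩⟩
  | add X Y _ _ hX hY =>
    obtain ⟨S, hS, hX⟩ := hX
    obtain ⟨S', hS', hY⟩ := hY
    refine ⟨S + S', Submodule.add_mem _ hS hS', fun a ha => ?_⟩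
    obtain ⟨C, hX⟩ := hX a ha
    obtain ⟨C', hY⟩ := hY a ha
    refine ⟨C + C', fun v => ?_⟩
    rw [mul_add, add_sub_add_comm, LinearMap.add_apply, map_add, add_mul]
    exact (norm_add_le _ _).trans (add_le_add (hX v) (hY v))
  | smul c X _ hX =>
    obtain ⟨S, hS, hX⟩ := hX
    refine ⟨c • S, Submodule.smul_mem _ c hS, fun a ha => ?_⟩
    obtain ⟨C, hX⟩ := hX a ha
    refine ⟨‖c‖ * C, fun v => ?_⟩
    have e : Δ.cpow (-z) * c • X - c • S = c • (Δ.cpow (-z) * X - S) := by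
      rw [mul_smul_comm]
      module
    rw [e, LinearMap.smul_apply, map_smul, mul_assoc]
    exact (norm_smul_le _ _).trans (mul_le_mul_of_nonneg_left (hX v) (norm_nonneg _))

/-- `Δ X = θ^r(X) Δ + [commutator]`, with both coefficients in `𝒟` and hence bounded at `a`; the
commutator has order `m + r - 1`. -/
theorem BoundedAt.add_order (hr : r ≠ 0) {a : ℝ} (ha : 𝒟.BoundedAt a) : 𝒟.BoundedAt (a + r) := by
  intro m X hX
  have hXa := 𝒟.filt_le_alg hX
  have hθ : ∀ n : ℕ, ((𝒟.θ ^ n) ⟨X, hXa⟩ : Module.End ℂ Δ.Hinf) ∈ 𝒟.filt m := by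
    intro n
    induction n with
    | zero => exact hX
    | succ n ih => rw [pow_succ', LinearEquiv.mul_apply, 𝒟.θ_mem_filt]; exact ih
  obtain ⟨C, hC, h⟩ := ha _ _ (hθ r)
  obtain ⟨C', hC', h'⟩ := ha _ _ (𝒟.twisted_commutator m ⟨X, hXa⟩ hX)
  obtain ⟨C₁, hC₁, h₁⟩ := Δ.exists_norm_dpow_le r (z := a + (m + r - 1 : ℕ))
    (w := (a + r : ℝ) + m) (by
      rw [Nat.cast_sub (by omega)]
      simp
      linarith)
  refine ⟨C + C' * C₁, by positivity, fun v => ?_⟩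
  have e : Δ.dpow r (a + r : ℝ) (X v) =
      Δ.dpow r a (((𝒟.θ ^ r) ⟨X, hXa⟩ : Module.End ℂ Δ.Hinf) (Δ.dpow r r v)) +
      Δ.dpow r a ((Δ.lap * X - ((𝒟.θ ^ r) ⟨X, hXa⟩ : Module.End ℂ Δ.Hinf) * Δ.lap) v) := by
    rw [← map_add, LinearMap.sub_apply, Module.End.mul_apply, Module.End.mul_apply, Δ.dpow_self hr,
      add_sub_cancel, ← Δ.dpow_self hr, dpow_dpow_apply]
    push_cast
    rfl
  have h2 := h (Δ.dpow r r v)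
  rw [dpow_dpow_apply] at h2
  rw [e, add_mul, mul_assoc]
  refine (norm_add_le _ _).trans (add_le_add ?_ ((h' v).trans
    (mul_le_mul_of_nonneg_left (h₁ v) hC')))
  push_cast
  rw [add_right_comm]
  exact h2

theorem BoundedAt.sub (hr : r ≠ 0)
    (hdiag : IsDiagonalizableEnd (V := 𝒟.alg) (𝒟.θ : Module.End ℂ 𝒟.alg))
    (hpos : HasPositiveSpectrum (V := 𝒟.alg) (𝒟.θ : Module.End ℂ 𝒟.alg))
    {a σ : ℝ} (h0 : 0 < σ) (h1 : σ < 1) (ha : 𝒟.BoundedAt a) : 𝒟.BoundedAt (a - r * σ) := by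
  intro m X hX
  -- Only degree `a` is known so far, so the expansion is used for `{a}` alone, with remainder of
  -- the same order as `S`.
  obtain ⟨S, hS, h⟩ := exists_cpow_neg_mul hr hdiag hpos (s := {a}) (by simpa using ha)
    (z := σ) (by simpa using h0) (by simpa using h1) (m - r * σ) hX
  obtain ⟨C, h⟩ := h a rfl
  obtain ⟨C', hC', h'⟩ := ha.norm_basicOperators_le hS
  refine ⟨|C| + C', by positivity, fun v => ?_⟩
  have e : Δ.dpow r (a - r * σ : ℝ) (X v) =
      Δ.dpow r a ((Δ.cpow (-σ) * X - S) v) + Δ.dpow r a (S v) := by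
    rw [← map_add, LinearMap.sub_apply, sub_add_cancel, Module.End.mul_apply, ← Δ.dpow_mul_nat hr,
      dpow_dpow_apply]
    push_cast
    rw [mul_neg, ← sub_eq_add_neg]
  have h2 := h v
  have h3 := h' v
  rw [Complex.ofReal_re] at h3
  have e2 : ((a - r * σ : ℝ) : ℂ) + m = a + ((m - r * σ : ℝ) : ℂ) := by push_cast; ring
  rw [e, add_mul, e2]
  exact (norm_add_le _ _).trans (add_le_add
    (h2.trans (mul_le_mul_of_nonneg_right (le_abs_self C) (norm_nonneg _))) h3)

/-- Climb from `0` to some `r * n > a`, then descend to `a` in `k` equal steps, `k` being large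
enough that each is shorter than `r`. -/
theorem boundedAt (hr : r ≠ 0)
    (hdiag : IsDiagonalizableEnd (V := 𝒟.alg) (𝒟.θ : Module.End ℂ 𝒟.alg))
    (hpos : HasPositiveSpectrum (V := 𝒟.alg) (𝒟.θ : Module.End ℂ 𝒟.alg)) (a : ℝ) :
    𝒟.BoundedAt a := by
  have hr' : (0 : ℝ) < r := by positivity
  have hup : ∀ n : ℕ, 𝒟.BoundedAt (r * n) := by
    intro n
    induction n with
    | zero => simpa using 𝒟.boundedAt_zero
    | succ n ih =>
      have := ih.add_order hr
      push_cast
      rwa [mul_add, mul_one]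
  obtain ⟨n, hn⟩ := exists_nat_gt (a / r)
  set x := n - a / r with hx
  have hx0 : 0 < x := by rw [hx]; linarith
  obtain ⟨k, hk⟩ := exists_nat_gt x
  have hk0 : (0 : ℝ) < k := hx0.trans hk
  have hdown : ∀ j : ℕ, 𝒟.BoundedAt (r * n - r * (x / k) * j) := by
    intro j
    induction j with
    | zero => simpa using hup n
    | succ j ih =>
      have := ih.sub hr hdiag hpos (div_pos hx0 hk0) ((div_lt_one hk0).2 hk)
      push_cast
      convert this using 1
      ring
  have h := hdown k
  have e : r * n - r * (x / k) * k = a := by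
    rw [hx]
    field_simp
    ring
  rwa [e] at h

theorem isOp_of_mem_filt (hb : ∀ a, 𝒟.BoundedAt a) {m : ℕ} {X : Module.End ℂ Δ.Hinf}
    (hX : X ∈ 𝒟.filt m) : Δ.IsOp r m X := by
  rw [isOp_iff]
  intro a
  obtain ⟨C, hC, h⟩ := hb a m X hX
  exact ⟨C, hC, fun v => by simpa using h v⟩

theorem isOp_of_mem_span (hb : ∀ a, 𝒟.BoundedAt a) {t : ℝ} {S : Module.End ℂ Δ.Hinf}
    (hS : S ∈ Submodule.span ℂ (𝒟.basicOperators t)) : Δ.IsOp r t S :=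
  isOp_iff.2 fun a => (hb a).norm_basicOperators_le hS

/-! ### The algebra of pseudodifferential operators -/

variable (𝒟)

/-- The operators which have, modulo operators of arbitrarily low order, an expansion in basic
operators of order at most `t`. -/
def psi (t : ℝ) : Submodule ℂ (Module.End ℂ Δ.Hinf) where
  carrier := {P | ∀ l : ℝ, ∃ S ∈ Submodule.span ℂ (𝒟.basicOperators t), Δ.IsOp r l (P - S)}
  add_mem' {P Q} hP hQ l := by
    obtain ⟨S, hS, hP⟩ := hP l
    obtain ⟨S', hS', hQ⟩ := hQ l
    exact ⟨S + S', Submodule.add_mem _ hS hS', by rw [add_sub_add_comm]; exact hP.add hQ⟩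
  zero_mem' l := ⟨0, zero_mem _, by rw [sub_zero]; exact isOp_zero⟩
  smul_mem' c P hP l := by
    obtain ⟨S, hS, hP⟩ := hP l
    exact ⟨c • S, Submodule.smul_mem _ c hS,
      by rw [show c • P - c • S = c • (P - S) by module]; exact hP.smul c⟩

variable {𝒟} {s t : ℝ} {P Q : Module.End ℂ Δ.Hinf}

theorem psi_mono : Monotone 𝒟.psi := fun _ _ hst _ hP l => by
  obtain ⟨S, hS, h⟩ := hP l
  exact ⟨S, Submodule.span_mono (𝒟.basicOperators_mono hst) hS, h⟩

theorem span_le_psi : Submodule.span ℂ (𝒟.basicOperators t) ≤ 𝒟.psi t := fun S hS _ =>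
  ⟨S, hS, by rw [sub_self]; exact isOp_zero⟩

/-- `Ψ^t` is closed under approximation modulo arbitrarily low order, so later proofs need only
treat basic operators. -/
theorem mem_psi_of_forall (h : ∀ l : ℝ, ∃ S ∈ 𝒟.psi t, Δ.IsOp r l (P - S)) : P ∈ 𝒟.psi t := by
  intro l
  obtain ⟨S, hS, h⟩ := h l
  obtain ⟨S', hS', h'⟩ := hS l
  exact ⟨S', hS', by rw [← sub_add_sub_cancel P S S']; exact h.add h'⟩

theorem isOp_of_mem_psi (hb : ∀ a, 𝒟.BoundedAt a) (hP : P ∈ 𝒟.psi t) : Δ.IsOp r t P := by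
  obtain ⟨S, hS, h⟩ := hP t
  rw [← sub_add_cancel P S]
  exact h.add (isOp_of_mem_span hb hS)

/-- A linear operation which maps basic operators of order `s` into `Ψ^t`, and shifts the analytic
order by a constant, maps `Ψ^s` into `Ψ^t`. -/
theorem map_mem_psi (f : Module.End ℂ Δ.Hinf →ₗ[ℂ] Module.End ℂ Δ.Hinf) (c : ℝ)
    (hf : ∀ S ∈ 𝒟.basicOperators s, f S ∈ 𝒟.psi t)
    (hc : ∀ l T, Δ.IsOp r l T → Δ.IsOp r (l + c) (f T)) (hP : P ∈ 𝒟.psi s) : f P ∈ 𝒟.psi t := by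
  refine mem_psi_of_forall fun l => ?_
  obtain ⟨S, hS, h⟩ := hP (l - c)
  refine ⟨f S, ?_, ?_⟩
  · exact (Submodule.span_le.2 hf : Submodule.span ℂ _ ≤ (𝒟.psi t).comap f) hS
  · rw [← map_sub]
    simpa using hc _ _ h

theorem mul_dpow_mem_psi (hP : P ∈ 𝒟.psi t) (z : ℂ) : P * Δ.dpow r z ∈ 𝒟.psi (t + z.re) := by
  refine map_mem_psi (LinearMap.mulRight ℂ (Δ.dpow r z)) z.re ?_
    (fun l T hT => hT.mul (isOp_dpow z)) hP
  rintro _ ⟨m, w, X, hX, hw, rfl⟩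
  change X * Δ.dpow r (w - m) * Δ.dpow r z ∈ _
  rw [mul_assoc, dpow_mul_dpow]
  refine span_le_psi (Submodule.subset_span (𝒟.mul_dpow_mem_basicOperators hX ?_))
  simp
  linarith

theorem mem_psi_of_mem_filt {m : ℕ} {X : Module.End ℂ Δ.Hinf} (hX : X ∈ 𝒟.filt m) :
    X ∈ 𝒟.psi m := by
  refine span_le_psi (Submodule.subset_span ?_)
  rw [← mul_one X, ← Δ.dpow_zero r]
  exact 𝒟.mul_dpow_mem_basicOperators hX (by simp)

theorem mul_mem_psi_of_mem_filt (hb : ∀ a, 𝒟.BoundedAt a) {m : ℕ} {X : Module.End ℂ Δ.Hinf}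
    (hX : X ∈ 𝒟.filt m) (hP : P ∈ 𝒟.psi t) : X * P ∈ 𝒟.psi (m + t) := by
  refine map_mem_psi (LinearMap.mulLeft ℂ X) m ?_
    (fun l T hT => by rw [add_comm]; exact (isOp_of_mem_filt hb hX).mul hT) hP
  rintro _ ⟨n, w, Y, hY, hw, rfl⟩
  change X * (Y * Δ.dpow r (w - n)) ∈ _
  rw [← mul_assoc]
  refine span_le_psi (Submodule.subset_span (𝒟.mul_dpow_mem_basicOperators
    (𝒟.mul_mem _ _ X hX Y hY) ?_))
  simp
  linarith

theorem dpow_mul_mem_psi_of_forall {z : ℂ}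
    (hz : ∀ m : ℕ, ∀ X ∈ 𝒟.filt m, Δ.dpow r z * X ∈ 𝒟.psi (z.re + m)) (hP : P ∈ 𝒟.psi t) :
    Δ.dpow r z * P ∈ 𝒟.psi (z.re + t) := by
  refine map_mem_psi (LinearMap.mulLeft ℂ (Δ.dpow r z)) z.re ?_
    (fun l T hT => by rw [add_comm]; exact (isOp_dpow z).mul hT) hP
  rintro _ ⟨n, w, Y, hY, hw, rfl⟩
  change Δ.dpow r z * (Y * Δ.dpow r (w - n)) ∈ _
  rw [← mul_assoc]
  refine psi_mono ?_ (mul_dpow_mem_psi (hz n Y hY) _)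
  simp
  linarith

theorem dpow_add_mul_mem_psi {z w : ℂ}
    (hz : ∀ m : ℕ, ∀ X ∈ 𝒟.filt m, Δ.dpow r z * X ∈ 𝒟.psi (z.re + m))
    (hw : ∀ m : ℕ, ∀ X ∈ 𝒟.filt m, Δ.dpow r w * X ∈ 𝒟.psi (w.re + m)) (m : ℕ)
    (X : Module.End ℂ Δ.Hinf) (hX : X ∈ 𝒟.filt m) :
    Δ.dpow r (z + w) * X ∈ 𝒟.psi ((z + w).re + m) := by
  rw [dpow_add, mul_assoc, Complex.add_re, add_assoc]
  exact dpow_mul_mem_psi_of_forall hz (hw m X hX)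

theorem dpow_nat_mul_mul_mem_psi {z : ℂ}
    (hz : ∀ m : ℕ, ∀ X ∈ 𝒟.filt m, Δ.dpow r z * X ∈ 𝒟.psi (z.re + m)) (n : ℕ) :
    ∀ m : ℕ, ∀ X ∈ 𝒟.filt m, Δ.dpow r (n * z) * X ∈ 𝒟.psi ((n * z).re + m) := by
  induction n with
  | zero =>
    intro m X hX
    simp only [Nat.cast_zero, zero_mul, dpow_zero, one_mul, Complex.zero_re, zero_add]
    exact mem_psi_of_mem_filt hX
  | succ n ih =>
    rw [show ((n + 1 : ℕ) : ℂ) * z = n * z + z by push_cast; ring]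
    exact dpow_add_mul_mem_psi ih hz

/-- The commutator relation itself expresses `Δ X` as `θ^r(X) Δ` plus an element of `𝒟^(m+r-1)`. -/
theorem lap_mul_mem_psi (hr : r ≠ 0) (m : ℕ) (X : Module.End ℂ Δ.Hinf) (hX : X ∈ 𝒟.filt m) :
    Δ.dpow r r * X ∈ 𝒟.psi ((r : ℂ).re + m) := by
  have hXa := 𝒟.filt_le_alg hX
  have hθ : ∀ n : ℕ, ((𝒟.θ ^ n) ⟨X, hXa⟩ : Module.End ℂ Δ.Hinf) ∈ 𝒟.filt m := by
    intro n
    induction n with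
    | zero => exact hX
    | succ n ih => rw [pow_succ', LinearEquiv.mul_apply, 𝒟.θ_mem_filt]; exact ih
  have h1 := mem_psi_of_mem_filt (𝒟.twisted_commutator m ⟨X, hXa⟩ hX)
  have h2 := mul_dpow_mem_psi (mem_psi_of_mem_filt (hθ r)) r
  rw [Δ.dpow_self hr] at h2 ⊢
  rw [← sub_add_cancel (Δ.lap * X) (((𝒟.θ ^ r) ⟨X, hXa⟩ : Module.End ℂ Δ.Hinf) * Δ.lap)]
  refine Submodule.add_mem _ (psi_mono ?_ h1) (psi_mono (by rw [add_comm]) h2)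
  rw [Nat.cast_sub (by omega)]
  simp
  linarith

theorem dpow_neg_mul_mem_psi (hr : r ≠ 0)
    (hdiag : IsDiagonalizableEnd (V := 𝒟.alg) (𝒟.θ : Module.End ℂ 𝒟.alg))
    (hpos : HasPositiveSpectrum (V := 𝒟.alg) (𝒟.θ : Module.End ℂ 𝒟.alg)) {z : ℂ} (h0 : 0 < z.re)
    (h1 : z.re < 1) (m : ℕ) (X : Module.End ℂ Δ.Hinf) (hX : X ∈ 𝒟.filt m) :
    Δ.dpow r (r * (-z)) * X ∈ 𝒟.psi ((r * (-z)).re + m) := by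
  intro l
  obtain ⟨S, hS, h⟩ := exists_cpow_neg_mul hr hdiag hpos (s := Set.univ)
    (fun a _ => boundedAt hr hdiag hpos a) h0 h1 l hX
  refine ⟨S, ?_, isOp_iff.2 fun a => ?_⟩
  · convert hS using 3
    simp
    ring
  · obtain ⟨C, h⟩ := h a trivial
    refine ⟨|C|, abs_nonneg C, fun v => ?_⟩
    rw [Δ.dpow_mul_nat hr]
    exact (h v).trans (mul_le_mul_of_nonneg_right (le_abs_self C) (norm_nonneg _))

/-- An arbitrary power is a product of `n` copies of `Δ` and `k` copies of `Δ^(-x/k)` with `0 < Re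
(x/k) < 1`, and each factor is already covered. -/
theorem dpow_mul_mem_psi (hr : r ≠ 0)
    (hdiag : IsDiagonalizableEnd (V := 𝒟.alg) (𝒟.θ : Module.End ℂ 𝒟.alg))
    (hpos : HasPositiveSpectrum (V := 𝒟.alg) (𝒟.θ : Module.End ℂ 𝒟.alg)) (z : ℂ)
    (hP : P ∈ 𝒟.psi t) : Δ.dpow r z * P ∈ 𝒟.psi (z.re + t) := by
  refine dpow_mul_mem_psi_of_forall ?_ hP
  have hr' : (0 : ℝ) < r := by positivity
  obtain ⟨n, hn⟩ := exists_nat_gt (z.re / r)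
  set x : ℂ := n - z / r with hx
  have hx0 : 0 < x.re := by
    rw [hx, Complex.sub_re, Complex.div_natCast_re, Complex.natCast_re]
    linarith
  obtain ⟨k, hk⟩ := exists_nat_gt x.re
  have hk0 : (0 : ℝ) < k := hx0.trans hk
  have h1 := dpow_nat_mul_mul_mem_psi (lap_mul_mem_psi (𝒟 := 𝒟) hr) n
  have h2 := dpow_nat_mul_mul_mem_psi (dpow_neg_mul_mem_psi hr hdiag hpos (z := x / k)
    (by rw [Complex.div_natCast_re]; exact div_pos hx0 hk0)
    (by rw [Complex.div_natCast_re]; exact (div_lt_one hk0).2 hk)) k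
  have h3 := dpow_add_mul_mem_psi h1 h2
  have e : n * (r : ℂ) + k * (r * -(x / k)) = z := by
    have hk1 : (k : ℂ) ≠ 0 := by exact_mod_cast hk0.ne'
    have hr1 : (r : ℂ) ≠ 0 := by exact_mod_cast hr
    rw [hx]
    field_simp
    ring
  rwa [e] at h3

theorem mul_mem_psi (hr : r ≠ 0)
    (hdiag : IsDiagonalizableEnd (V := 𝒟.alg) (𝒟.θ : Module.End ℂ 𝒟.alg))
    (hpos : HasPositiveSpectrum (V := 𝒟.alg) (𝒟.θ : Module.End ℂ 𝒟.alg))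
    (hP : P ∈ 𝒟.psi s) (hQ : Q ∈ 𝒟.psi t) : P * Q ∈ 𝒟.psi (s + t) := by
  have hb := boundedAt hr hdiag hpos
  refine map_mem_psi (LinearMap.mulRight ℂ Q) t ?_
    (fun l T hT => hT.mul (isOp_of_mem_psi hb hQ)) hP
  rintro _ ⟨m, z, X, hX, hz, rfl⟩
  change X * Δ.dpow r (z - m) * Q ∈ _
  rw [mul_assoc]
  refine psi_mono ?_ (mul_mem_psi_of_mem_filt hb hX (dpow_mul_mem_psi hr hdiag hpos (z - m) hQ))
  simp
  linarith

theorem conjPow_mem_psi (hr : r ≠ 0)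
    (hdiag : IsDiagonalizableEnd (V := 𝒟.alg) (𝒟.θ : Module.End ℂ 𝒟.alg))
    (hpos : HasPositiveSpectrum (V := 𝒟.alg) (𝒟.θ : Module.End ℂ 𝒟.alg)) (z : ℂ)
    (hP : P ∈ 𝒟.psi t) : Δ.conjPow r z P ∈ 𝒟.psi t := by
  have h := mul_dpow_mem_psi (dpow_mul_mem_psi hr hdiag hpos z hP) (-z)
  rwa [Complex.neg_re, show z.re + t + -z.re = t by ring] at h

theorem conjPow_mem_psi_iff (hr : r ≠ 0)
    (hdiag : IsDiagonalizableEnd (V := 𝒟.alg) (𝒟.θ : Module.End ℂ 𝒟.alg))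
    (hpos : HasPositiveSpectrum (V := 𝒟.alg) (𝒟.θ : Module.End ℂ 𝒟.alg)) (z : ℂ) :
    Δ.conjPow r z P ∈ 𝒟.psi t ↔ P ∈ 𝒟.psi t := by
  refine ⟨fun h => ?_, conjPow_mem_psi hr hdiag hpos z⟩
  have h1 := conjPow_mem_psi hr hdiag hpos (-z) h
  have h2 := (Δ.conjPow r z).symm_apply_apply P
  rw [conjPow_apply, neg_neg] at h1
  exact h2 ▸ h1

/-- The twisting agrees with conjugation by `Δ^(1/r)` up to operators of lower order. -/
theorem conjPow_one_sub_twisting_mem (hr : 2 ≤ r)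
    (hdiag : IsDiagonalizableEnd (V := 𝒟.alg) (𝒟.θ : Module.End ℂ 𝒟.alg))
    (hpos : HasPositiveSpectrum (V := 𝒟.alg) (𝒟.θ : Module.End ℂ 𝒟.alg)) {m : ℕ}
    {X : Module.End ℂ Δ.Hinf} (hX : X ∈ 𝒟.filt m) (hXa : X ∈ 𝒟.alg) :
    Δ.conjPow r 1 X - (𝒟.θ ⟨X, hXa⟩ : Module.End ℂ Δ.Hinf) ∈ 𝒟.psi (m - 1) := by
  have hr0 : r ≠ 0 := by omega
  have hr2 : (2 : ℝ) ≤ r := by exact_mod_cast hr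
  have hspan := 𝒟.mem_span_isEigen hdiag hpos hX
  -- Summands in the span must be known to lie in `𝒟.alg` for the twisting to apply to them.
  have hle : Submodule.span ℂ {Y | ∃ ν, 𝒟.IsEigen m ν Y} ≤ 𝒟.filt m :=
    Submodule.span_le.2 fun Y ⟨_, hY⟩ => hY.1
  clear hX
  induction hspan using Submodule.span_induction with
  | mem X hX =>
    obtain ⟨ν, hX⟩ := hX
    obtain ⟨h, hθ⟩ := hX.2.2
    have hθ' : (𝒟.θ ⟨X, hXa⟩ : Module.End ℂ Δ.Hinf) = (ν : ℂ) • X := by rw [hθ]; rfl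
    rw [hθ']
    -- Chosen so that `Δ Δ^(-z) = Δ^(1/r)`; it lies in `(0, 1)` because `r ≥ 2`. Multiplying the
    -- leading-term formula by `Δ` on the left and `Δ^(-1/r)` on the right gives `Δ^(1/r) X Δ^(-1/r)
    -- ≡ μ^(-z) Δ X Δ⁻¹` with `μ = ν^r`, and `Δ X Δ⁻¹ ≡ μ X`, both modulo `Ψ^(m-1)`.
    set z : ℂ := ((1 - (r : ℝ)⁻¹ : ℝ) : ℂ) with hz
    have hinv : (r : ℝ)⁻¹ < 1 := inv_lt_one_of_one_lt₀ (by linarith)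
    have hinv0 : 0 < (r : ℝ)⁻¹ := by positivity
    have hrz : (r : ℝ) * z.re = r - 1 := by
      rw [hz, Complex.ofReal_re, mul_sub, mul_one, mul_inv_cancel₀ (by positivity)]
    have hrz' : (r : ℂ) * -z = -(r - 1) := by
      have : (r : ℂ) ≠ 0 := by exact_mod_cast hr0
      rw [hz]
      push_cast
      field_simp
    have hrem : Δ.cpow (-z) * X - ((ν ^ r : ℝ) : ℂ) ^ (-z) • (X * Δ.cpow (-z)) ∈
        𝒟.psi (m - r) := by
      intro l
      obtain ⟨S, hS, h⟩ := hX.exists_cpow_neg_mul hr0 hdiag hpos (s := Set.univ)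
        (fun a _ => boundedAt hr0 hdiag hpos a) (z := z) (by simp [hz]; linarith)
        (by simp [hz]; linarith) l
      refine ⟨S, ?_, isOp_iff.2 fun a => ?_⟩
      · rw [hrz] at hS
        convert hS using 3
        ring
      · obtain ⟨C, h⟩ := h a trivial
        exact ⟨|C|, abs_nonneg C, fun v =>
          (h v).trans (mul_le_mul_of_nonneg_right (le_abs_self C) (norm_nonneg _))⟩
    rw [← Δ.dpow_mul_nat hr0, hrz'] at hrem
    have hν0 : (ν : ℂ) ≠ 0 := by exact_mod_cast hX.2.1.ne'
    have hpow : ((ν ^ r : ℝ) : ℂ) ^ (-z) * ((ν ^ r : ℝ) : ℂ) = ν := by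
      have hνr : (0 : ℝ) ≤ ν ^ r := (pow_pos hX.2.1 r).le
      rw [hz, ← Complex.ofReal_neg, ← Complex.ofReal_cpow hνr, ← Complex.ofReal_mul]
      congr 1
      nth_rewrite 2 [← Real.rpow_one (ν ^ r)]
      rw [← Real.rpow_add (pow_pos hX.2.1 r), show -(1 - (r : ℝ)⁻¹) + 1 = (r : ℝ)⁻¹ by ring,
        Real.pow_rpow_inv_natCast hX.2.1.le hr0]
    have h1 := mul_dpow_mem_psi (dpow_mul_mem_psi hr0 hdiag hpos r hrem) (-1)
    have h2 := mul_dpow_mem_psi (mem_psi_of_mem_filt hX.commutator_mem) (-(r : ℂ))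
    have h3 := Submodule.add_mem _ (psi_mono (b := (m : ℝ) - 1) ?_ h1)
      (Submodule.smul_mem _ (((ν ^ r : ℝ) : ℂ) ^ (-z)) (psi_mono ?_ h2))
    · convert h3 using 1
      rw [mul_sub, sub_mul, sub_mul, mul_smul_comm, smul_mul_assoc, smul_sub, ← mul_assoc,
        dpow_mul_dpow, ← mul_assoc, ← Δ.dpow_self hr0, mul_assoc (Δ.dpow r r * X), dpow_mul_dpow,
        smul_mul_assoc, smul_smul, hpow, mul_assoc X, dpow_mul_neg, mul_one, conjPow_apply,
        show (r : ℂ) + -(r - 1) = 1 by ring, show -((r : ℂ) - 1) + -1 = -r by ring]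
      abel
    · simp
    · rw [Nat.cast_sub (by omega)]
      simp
      linarith
  | zero =>
    have e : (⟨0, hXa⟩ : 𝒟.alg) = 0 := rfl
    rw [e, map_zero, map_zero]
    simp
  | add X Y hX hY ihX ihY =>
    have hXa' := 𝒟.filt_le_alg (hle hX)
    have hYa' := 𝒟.filt_le_alg (hle hY)
    have e : (⟨X + Y, hXa⟩ : 𝒟.alg) = ⟨X, hXa'⟩ + ⟨Y, hYa'⟩ := rfl
    rw [e, map_add, map_add]
    have := Submodule.add_mem _ (ihX hXa') (ihY hYa')
    rw [← add_sub_add_comm] at this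
    exact this
  | smul c X hX ihX =>
    have hXa' := 𝒟.filt_le_alg (hle hX)
    have e : (⟨c • X, hXa⟩ : 𝒟.alg) = c • ⟨X, hXa'⟩ := rfl
    rw [e, map_smul, map_smul]
    have := Submodule.smul_mem _ c (ihX hXa')
    convert this using 1
    change c • _ - c • _ = _
    module

/-- The twisted algebra of pseudodifferential operators generated by a twisted algebra of
differential operators and the complex powers of `Δ`. -/
noncomputable def toTwistedPsiDO (𝒟 : TwistedDO Δ r) (hr : r ≠ 0)
    (hdiag : IsDiagonalizableEnd (V := 𝒟.alg) (𝒟.θ : Module.End ℂ 𝒟.alg))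
    (hpos : HasPositiveSpectrum (V := 𝒟.alg) (𝒟.θ : Module.End ℂ 𝒟.alg)) : TwistedPsiDO Δ r where
  alg :=
    { carrier := {P | ∃ t, P ∈ 𝒟.psi t}
      add_mem' := by
        rintro P Q ⟨s, hP⟩ ⟨t, hQ⟩
        exact ⟨max s t, Submodule.add_mem _ (psi_mono (le_max_left _ _) hP)
          (psi_mono (le_max_right _ _) hQ)⟩
      zero_mem' := ⟨0, zero_mem _⟩
      mul_mem' := by
        rintro P Q ⟨s, hP⟩ ⟨t, hQ⟩
        exact ⟨s + t, mul_mem_psi hr hdiag hpos hP hQ⟩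
      smul_mem' := by
        rintro c P ⟨t, hP⟩
        exact ⟨t, Submodule.smul_mem _ c hP⟩ }
  filt := 𝒟.psi
  filt_mono := psi_mono
  mul_mem _ _ _ hP _ hQ := mul_mem_psi hr hdiag hpos hP hQ
  exhaustive _ := Iff.rfl
  isOp := by
    rintro P ⟨t, hP⟩
    exact ⟨t, isOp_of_mem_psi (boundedAt hr hdiag hpos) hP⟩
  Θ z :=
    { toFun := fun P => ⟨Δ.conjPow r z P, P.2.imp fun _ => conjPow_mem_psi hr hdiag hpos z⟩
      invFun := fun P => ⟨(Δ.conjPow r z).symm P, P.2.imp fun _ h =>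
        (conjPow_mem_psi_iff hr hdiag hpos z).1 (by rwa [AlgEquiv.apply_symm_apply])⟩
      map_add' := fun P Q => Subtype.ext (map_add (Δ.conjPow r z) P.1 Q.1)
      map_smul' := fun c P => Subtype.ext (map_smul (Δ.conjPow r z) c P.1)
      left_inv := fun P => Subtype.ext ((Δ.conjPow r z).symm_apply_apply P.1)
      right_inv := fun P => Subtype.ext ((Δ.conjPow r z).apply_symm_apply P.1) }
  Θ_mul z P Q := Subtype.ext (map_mul (Δ.conjPow r z) P.1 Q.1)
  Θ_mem_filt z t P := conjPow_mem_psi_iff hr hdiag hpos z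
  cpow_mul_mem z t P hP := dpow_mul_mem_psi hr hdiag hpos z hP
  mul_cpow_mem z t P hP := by rw [add_comm]; exact mul_dpow_mem_psi hP z
  twisted_commutator z t P hP := by
    change Δ.dpow r z * (P : Module.End ℂ Δ.Hinf) -
      (Δ.dpow r z * (P : Module.End ℂ Δ.Hinf) * Δ.dpow r (-z)) * Δ.dpow r z ∈ _
    -- The twisting is exact conjugation, so the twisted commutator vanishes.
    rw [mul_assoc _ (Δ.dpow r (-z)), dpow_neg_mul, mul_one, sub_self]
    exact zero_mem _
  isOp_zero P hP := isOp_of_mem_psi (boundedAt hr hdiag hpos) hP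

end TwistedDO

theorem mainTheorem1 {H : Type*} [NormedAddCommGroup H] [InnerProductSpace ℂ H] [CompleteSpace H]
    (Δ : AbstractLaplacian H) (r : ℕ) (hr : 2 ≤ r)
    (𝒜 : NonUnitalSubalgebra ℂ (Module.End ℂ Δ.Hinf))
    (θ : 𝒜 ≃ₗ[ℂ] 𝒜) (hθ : ∀ a b : 𝒜, θ (a * b) = θ a * θ b) :
    ((∃ Ψ : TwistedPsiDO Δ r, Ψ.Compatible 𝒜 θ) → ∃ ℬ : TwistedPsiDO₀ Δ r, ℬ.Compatible 𝒜 θ) ∧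
    ((∃ ℬ : TwistedPsiDO₀ Δ r, ℬ.Compatible 𝒜 θ) → ∃ 𝒟 : TwistedDO Δ r, 𝒟.Compatible 𝒜 θ) ∧
    (∀ 𝒟 : TwistedDO Δ r, 𝒟.Compatible 𝒜 θ →
      IsDiagonalizableEnd (𝒟.θ : Module.End ℂ 𝒟.alg) →
      HasPositiveSpectrum (𝒟.θ : Module.End ℂ 𝒟.alg) →
      ∃ Ψ : TwistedPsiDO Δ r, Ψ.Compatible 𝒜 θ ∧
        (∀ (t : ℝ) (P : Module.End ℂ Δ.Hinf), P ∈ Ψ.filt t ↔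
          ∀ l : ℝ, ∃ S ∈ Submodule.span ℂ (𝒟.basicOperators t), Δ.IsOp r l (P - S)) ∧
        (∀ (z : ℂ) (P : Ψ.alg), (Ψ.Θ z P : Module.End ℂ Δ.Hinf) =
          Δ.cpow (z / r) * (P : Module.End ℂ Δ.Hinf) * Δ.cpow (-z / r))) := by
  refine ⟨fun ⟨Ψ, h⟩ => Ψ.exists_twistedPsiDO₀ h, fun ⟨ℬ, h⟩ => ℬ.exists_twistedDO (by omega) h,
    fun 𝒟 hc hdiag hpos => ?_⟩
  refine ⟨𝒟.toTwistedPsiDO (by omega) hdiag hpos, fun a => ?_, fun _ _ => Iff.rfl,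
    fun _ _ => rfl⟩
  obtain ⟨ha, haD, hθa⟩ := hc a
  have ha0 : (a : Module.End ℂ Δ.Hinf) ∈ 𝒟.psi 0 := by
    simpa using TwistedDO.mem_psi_of_mem_filt ha
  refine ⟨ha0, ⟨0, ha0⟩, ?_⟩
  have h := TwistedDO.conjPow_one_sub_twisting_mem hr hdiag hpos ha haD
  rw [hθa, Nat.cast_zero, zero_sub] at h
  exact h
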